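/- Let $\Omega\subset\mathbb R^d$ be convex and compact and let $0<\alpha<1$. An admissible pair $(\rho,q)$ consists of a weakly* continuous curve $t\in[0,1]\mapsto\rho_t\in\mathcal P(\Omega)$ and a family $q=(q_t)_{t\in[0,1]}$ of $\mathbb R^d$-valued measures on $\Omega$ that is weakly measurable in $t$ with $\int_0^1|q_t|(\Omega)\,dt<\infty$, such that $$\int_0^1\Big[\int_\Omega\partial_t\phi(t,x)\,d\rho_t(x)+\int_\Omega D_x\phi(t,x)\cdot dq_t(x)\Big]dt=0$$ for every $\phi\in C^\infty(\mathbb R\times\mathbb R^d)$ with $\phi(0,x)=\phi(1,x)=0$ for all $x\in\Omega$. Let $F(\rho_t,q_t)=G_\alpha(|v_t|^{1/\alpha}\rho_t)$ if $q_t=v_t\,\rho_t$ with $v_t\in L^1(\rho_t;\mathbb R^d)$, and $F(\rho_t,q_t)=+\infty$ if $q_t$ is not absolutely continuous with respect to $\rho_t$; here $G_\alpha(\lambda)=\sum_{x\in\Omega}\lambda(\{x\})^\alpha$ if the positive measure $\lambda$ is purely atomic and $G_\alpha(\lambda)=+\infty$ otherwise. Put $\mathcal F(\rho,q)=\int_0^1F(\rho_t,q_t)\,dt$.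 A sequence $(\rho^n,q^n)$ is said to $\tau$-converge to $(\rho,q)$ if $\int\rho^n_t\,dt\rightharpoonup\int\rho_t\,dt$ and $\int q^n_t\,dt\rightharpoonup\int q_t\,dt$ weakly* as measures on $[0,1]\times\Omega$ and $\sup_{n\in\mathbb N,\,t\in[0,1]}F(\rho^n_t,q^n_t)<+\infty$. Theorem. Let $(\rho^n,q^n)$ be a sequence of admissible pairs with $\mathcal F(\rho^n,q^n)\le C<+\infty$ for every $n$. Then, up to a time reparametrization, the sequence is $\tau$-compact, with admissible limits. Precisely, for every $n$ there are an increasing bijection $\varphi_n$ of $[0,1]$, absolutely continuous together with its inverse, and an admissible pair $(\tilde\rho^n,\tilde q^n)$ with $\tilde\rho^n_t=\rho^n_{\varphi_n(t)}$ for every $t$ and $\tilde q^n_t=\varphi_n'(t)\,q^n_{\varphi_n(t)}$ for a.e. $t$, such that every subsequence of $(\tilde\rho^n,\tilde q^n)$ has a further subsequence that $\tau$-converges to an admissible pair $(\rho,q)$; in particular $t\mapsto\rho_t$ is weakly* continuous and the limit of the momenta is of the form $\int q_t\,dt$. -/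

import Mathlib

open MeasureTheory Filter Topology
open scoped ENNReal NNReal unitInterval

noncomputable section

namespace BranchedTransport

/-- A positive measure is purely atomic if it is concentrated on a countable set. -/
def IsPurelyAtomic {X : Type*} [MeasurableSpace X] (m : Measure X) : Prop :=
  ∃ s : Set X, s.Countable ∧ m sᶜ = 0

open Classical in
/-- The functional `G_α` on positive measures: the sum (that is, the integral against the counting
measure) of `m({x})^α` if `m` is purely atomic, and `+∞` otherwise. -/
def atomicEnergy {X : Type*} [MeasurableSpace X] (α : ℝ) (m : Measure X) : ℝ≥0∞ :=
  if IsPurelyAtomic m then ∑' x : X, m {x} ^ α else ⊤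

variable {d : ℕ} {Ω : Set (EuclideanSpace ℝ (Fin d))}

/-- The cost `F(ρ, q)`: it is `G_α(|v|^{1/α} ρ)` if `q = v ρ` with `v` in `L¹(ρ)`, and `+∞` if `q`
has no density with respect to `ρ`. Since `v` is unique up to `ρ`-null sets, the infimum runs over
at most one value, and it is `⊤` if there is none. -/
def momentumCost (α : ℝ) (ρ : Measure Ω) (q : VectorMeasure Ω (EuclideanSpace ℝ (Fin d))) :
    ℝ≥0∞ :=
  ⨅ (v : Ω → EuclideanSpace ℝ (Fin d)) (_ : Integrable v ρ ∧ q = ρ.withDensityᵥ v),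
    atomicEnergy α (ρ.withDensity fun x => ‖v x‖ₑ ^ (1 / α))

/-- The integral `∫ Ψ · dq` of a vector field against a vector measure. -/
def pairing (q : VectorMeasure Ω (EuclideanSpace ℝ (Fin d)))
    (Ψ : Ω → EuclideanSpace ℝ (Fin d)) : ℝ :=
  ∫ᵛ x, Ψ x ∂[innerSL ℝ; q]

variable (Ω) in
/-- The data of a pair `(ρ, q)`: a family of probability measures and a family of vector measures on
`Ω`, both indexed by the time `t ∈ [0,1]`. -/
structure Flow where
  /-- the mass distribution at time `t` -/
  rho : I → ProbabilityMeasure Ω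
  /-- the momentum at time `t` -/
  mom : I → VectorMeasure Ω (EuclideanSpace ℝ (Fin d))

/-- `q ∈ L¹([0,1]; M(Ω; ℝ^d))`: the family is weakly measurable in time and its total variation is
integrable in time. -/
def MemL1 (q : I → VectorMeasure Ω (EuclideanSpace ℝ (Fin d))) : Prop :=
  (∀ A : Set Ω, MeasurableSet A → AEMeasurable (fun t => q t A) volume) ∧
    ∫⁻ t : I, (q t).variation Set.univ < ⊤

/-- The weak form of `∂_t ρ + div_x q = 0` in `[0,1] × Ω` with no flux through `∂Ω`: the test
functions are smooth up to the boundary of `Ω` and vanish at times `0` and `1`. -/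
def ContinuityEquation (f : Flow Ω) : Prop :=
  ∀ φ : ℝ × EuclideanSpace ℝ (Fin d) → ℝ,
    ContDiff ℝ ((⊤ : ℕ∞) : WithTop ℕ∞) φ →
    (∀ x ∈ Ω, φ (0, x) = 0 ∧ φ (1, x) = 0) →
    ∫ t : I, ((∫ x : Ω, deriv (fun s : ℝ => φ (s, (x : EuclideanSpace ℝ (Fin d)))) (t : ℝ)
          ∂(f.rho t : Measure Ω)) +
        pairing (f.mom t) fun x : Ω =>
          gradient (fun y => φ ((t : ℝ), y)) (x : EuclideanSpace ℝ (Fin d))) = 0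

/-- The class of admissible pairs: `ρ` is weakly continuous in time, `q` is integrable in time, and
the continuity equation holds. -/
structure IsAdmissible (f : Flow Ω) : Prop where
  continuous_rho : Continuous f.rho
  memL1_mom : MemL1 f.mom
  continuityEquation : ContinuityEquation f

/-- The total cost: the integral over `[0,1]` of `F(ρ_t, q_t)`. -/
def totalCost (α : ℝ) (f : Flow Ω) : ℝ≥0∞ :=
  ∫⁻ t : I, momentumCost α (f.rho t : Measure Ω) (f.mom t)

/-- Weak convergence, on `[0,1] × Ω`, of the measures `∫ ρⁿ_t dt` to `∫ ρ_t dt` and of the vector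
measures `∫ qⁿ_t dt` to `∫ q_t dt`. -/
def WeakTendsto (u : ℕ → Flow Ω) (f : Flow Ω) : Prop :=
  (∀ g : C(I × Ω, ℝ),
    Tendsto (fun n => ∫ t : I, ∫ x : Ω, g (t, x) ∂((u n).rho t : Measure Ω)) atTop
      (𝓝 (∫ t : I, ∫ x : Ω, g (t, x) ∂(f.rho t : Measure Ω)))) ∧
  ∀ Ψ : C(I × Ω, EuclideanSpace ℝ (Fin d)),
    Tendsto (fun n => ∫ t : I, pairing ((u n).mom t) fun x => Ψ (t, x)) atTop
      (𝓝 (∫ t : I, pairing (f.mom t) fun x => Ψ (t, x)))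

/-- `τ`-convergence: weak convergence together with `sup_{n,t} F(ρⁿ_t, qⁿ_t) < ∞`. -/
def TauTendsto (α : ℝ) (u : ℕ → Flow Ω) (f : Flow Ω) : Prop :=
  WeakTendsto u f ∧ (⨆ (n : ℕ) (t : I), momentumCost α ((u n).rho t : Measure Ω) ((u n).mom t)) < ⊤

/-- A sequence is `τ`-compact in the class of admissible pairs: each of its subsequences has a
further subsequence that `τ`-converges to an admissible pair. -/
def TauCompact (α : ℝ) (u : ℕ → Flow Ω) : Prop :=
  ∀ a : ℕ → ℕ, StrictMono a → ∃ b : ℕ → ℕ, StrictMono b ∧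
    ∃ f : Flow Ω, IsAdmissible f ∧ TauTendsto α (fun n => u (a (b n))) f

/-- An increasing bijection of `[0,1]`, seen as a function on `ℝ`, constant outside `[0,1]`. -/
def timeExtend (φ : I ≃o I) : ℝ → ℝ :=
  Set.IccExtend (zero_le_one : (0 : ℝ) ≤ 1) fun t : I => ((φ t : I) : ℝ)

/-- `g` is obtained from `f` by reparametrization in time: `ρ̃_t = ρ_{φ(t)}` for every `t` and
`q̃_t = φ'(t) q_{φ(t)}` for almost every `t`, where `φ` is an increasing bijection of `[0,1]` that is
absolutely continuous together with its inverse. -/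
def IsTimeReparametrization (f g : Flow Ω) : Prop :=
  ∃ φ : I ≃o I,
    AbsolutelyContinuousOnInterval (timeExtend φ) 0 1 ∧
    AbsolutelyContinuousOnInterval (timeExtend φ.symm) 0 1 ∧
    (∀ t : I, g.rho t = f.rho (φ t)) ∧
    ∀ᵐ t : I, g.mom t = deriv (timeExtend φ) (t : ℝ) • f.mom (φ t)

end BranchedTransport

end

noncomputable section

namespace BranchedTransport

variable {d : ℕ} {Ω : Set (EuclideanSpace ℝ (Fin d))}

/-! If `q = v ρ` has finite cost, then `v` vanishes `ρ`-a.e. off the atoms of `ρ`, and the cost is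
`∑ |v(x)| ρ({x})^α = ∫ |v| ρ({x})^(α-1) dρ` (`momentumCost_eq`). Two facts follow. The cost is
homogeneous of degree one in `q`, so a time change can spread it evenly over `[0,1]`. And since
`ρ({x}) ≤ 1` and `α < 1`, the weight is at least `1`, so the cost dominates the total mass `|q|(Ω)`.

Let `h(t)` be the cost at time `t`. Running time with density proportional to `1 + h` makes the cost
at most `1 + C` at every time (`exists_timeChange`, `exists_reparametrization`). The time change is
only absolutely continuous, and composing it with a smooth test function leaves the class of test
functions. The continuity equation is therefore rewritten as an identity for the increments of `t ↦
∫ χ dρ_t` with `χ` smooth in space (`HasIncrements`), which an ordinary change of variables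
preserves, and is then recovered from it.

After reparametrization the momenta have mass at most `1 + C` at almost every time, so `t ↦ ∫ χ
dρ_t` is Lipschitz uniformly in `n`. An Arzelà–Ascoli argument yields convergence at every time to a
continuous curve (`exists_subseq_tendsto_curve`). The momenta are encoded as probability measures on
`[0,1] × Ω × ball` whose time marginal is Lebesgue measure. This marginal survives weak limits, so
the limit disintegrates in time, which gives a momentum of the form `∫ q_t dt` (`exists_lift`,
`exists_disintegration`). The continuity equation is linear and passes to the limit. Only the costs
along the sequence have to be bounded, so no lower semicontinuity of the cost is involved. -/

/-! ### Integration against vector measures with a density -/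

theorem isFiniteMeasure_variation_withDensityᵥ {X E : Type*} [MeasurableSpace X]
    [NormedAddCommGroup E] [NormedSpace ℝ E] [CompleteSpace E] {ρ : Measure X} {v : X → E}
    (hv : Integrable v ρ) : IsFiniteMeasure (ρ.withDensityᵥ v).variation := by
  rw [Measure.variation_withDensityᵥ hv]
  exact ⟨by simpa using! hv.2⟩

theorem integrable_inner_of_bound {X E : Type*} [MeasurableSpace X] [NormedAddCommGroup E]
    [InnerProductSpace ℝ E] {ρ : Measure X} {v Ψ : X → E} (hv : Integrable v ρ)
    (hΨ : AEStronglyMeasurable Ψ ρ) {C : ℝ} (hC : ∀ x, ‖Ψ x‖ ≤ C) :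
    Integrable (fun x => inner ℝ (Ψ x) (v x)) ρ := by
  refine (hv.norm.const_mul C).mono' (hΨ.inner hv.aestronglyMeasurable) (ae_of_all _ fun x => ?_)
  exact (norm_inner_le_norm _ _).trans (by gcongr; exact hC x)

theorem integral_simpleFunc_withDensityᵥ {X E : Type*} [MeasurableSpace X] [NormedAddCommGroup E]
    [InnerProductSpace ℝ E] [CompleteSpace E] {ρ : Measure X} {v : X → E} (hv : Integrable v ρ)
    (f : SimpleFunc X E) :
    VectorMeasure.integral (ρ.withDensityᵥ v) f (innerSL ℝ) = ∫ x, inner ℝ (f x) (v x) ∂ρ := by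
  have hfin := isFiniteMeasure_variation_withDensityᵥ hv
  have hint : ∀ g : SimpleFunc X E, Integrable (fun x => inner ℝ (g x) (v x)) ρ := by
    intro g
    obtain ⟨C, hC⟩ := g.exists_forall_norm_le
    exact integrable_inner_of_bound hv g.stronglyMeasurable.aestronglyMeasurable hC
  have hint' : ∀ g : SimpleFunc X E, (ρ.withDensityᵥ v).Integrable g := by
    intro g
    obtain ⟨C, hC⟩ := g.exists_forall_norm_le
    exact Integrable.of_bound g.stronglyMeasurable.aestronglyMeasurable C (ae_of_all _ hC)
  induction f using SimpleFunc.induction with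
  | @const c s hs =>
    have h1 : (⇑((SimpleFunc.const X c).piecewise s hs (SimpleFunc.const X 0)) : X → E)
        = s.indicator fun _ => c := by
      ext x; by_cases hx : x ∈ s <;> simp [hx]
    have h2 : (fun x => inner ℝ (s.indicator (fun _ => c) x) (v x))
        = s.indicator fun x => inner ℝ c (v x) := by
      ext x; by_cases hx : x ∈ s <;> simp [hx]
    rw [h1, h2, VectorMeasure.integral_indicator_const _ hs, integral_indicator hs,
      withDensityᵥ_apply hv hs, integral_inner hv.integrableOn]
    rfl
  | add hd hf hg =>
    rw [SimpleFunc.coe_add, VectorMeasure.integral_add (hint' _) (hint' _), hf, hg]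
    simp only [Pi.add_apply, inner_add_left]
    rw [integral_add (hint _) (hint _)]

/-- Simple functions are dense enough: approximations of `Ψ` bounded by the same `C` converge
pointwise, and dominated convergence applies on both sides. -/
theorem integral_withDensityᵥ {X E : Type*} [MeasurableSpace X] [NormedAddCommGroup E]
    [InnerProductSpace ℝ E] [CompleteSpace E] {ρ : Measure X} {v Ψ : X → E} (hv : Integrable v ρ)
    (hΨ : StronglyMeasurable Ψ) {C : ℝ} (hC : ∀ x, ‖Ψ x‖ ≤ C) :
    VectorMeasure.integral (ρ.withDensityᵥ v) Ψ (innerSL ℝ) = ∫ x, inner ℝ (Ψ x) (v x) ∂ρ := by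
  have hfin := isFiniteMeasure_variation_withDensityᵥ hv
  rcases isEmpty_or_nonempty X with hX | ⟨⟨x₀⟩⟩
  · rw [VectorMeasure.integral_of_isEmpty, ρ.eq_zero_of_isEmpty, integral_zero_measure]
  have hC0 : 0 ≤ C := (norm_nonneg _).trans (hC x₀)
  have hlim : ∀ x, Tendsto (fun n => hΨ.approxBounded C n x) atTop (𝓝 (Ψ x)) := fun x =>
    hΨ.tendsto_approxBounded_of_norm_le (hC x)
  have h1 := VectorMeasure.tendsto_integral_of_dominated_convergence (μ := ρ.withDensityᵥ v)
    (B := innerSL ℝ) (f := Ψ) (fun _ => C)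
    (fun n => (hΨ.approxBounded C n).stronglyMeasurable.aestronglyMeasurable)
    (integrable_const _) (fun n => ae_of_all _ fun x => hΨ.norm_approxBounded_le hC0 n x)
    (ae_of_all _ hlim)
  have h2 := tendsto_integral_of_dominated_convergence (μ := ρ)
    (F := fun n x => inner ℝ (hΨ.approxBounded C n x) (v x))
    (f := fun x => inner ℝ (Ψ x) (v x)) (fun x => C * ‖v x‖)
    (fun n => (hΨ.approxBounded C n).stronglyMeasurable.aestronglyMeasurable.inner
      hv.aestronglyMeasurable)
    (hv.norm.const_mul C)
    (fun n => ae_of_all _ fun x => (norm_inner_le_norm _ _).trans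
      (by gcongr; exact hΨ.norm_approxBounded_le hC0 n x))
    (ae_of_all _ fun x => (hlim x).inner tendsto_const_nhds)
  refine tendsto_nhds_unique h1 (h2.congr fun n => ?_)
  exact (integral_simpleFunc_withDensityᵥ hv _).symm

/-! ### The cost as a weighted integral over atoms -/

theorem countable_setOf_measure_singleton_ne_zero {X : Type*} [MeasurableSpace X]
    [MeasurableSingletonClass X] (ρ : Measure X) [SFinite ρ] : {x | ρ {x} ≠ 0}.Countable := by
  have := Measure.countable_meas_pos_of_disjoint_iUnion (μ := ρ) (As := fun x : X => {x})
    (fun x => measurableSet_singleton x) (fun x y h => by simpa using h)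
  simpa [pos_iff_ne_zero] using this

/-- The integral `∫ |v| ρ({x})^(α-1) dρ`. -/
def atomicCost {X E : Type*} [MeasurableSpace X] [NormedAddCommGroup E] (α : ℝ) (ρ : Measure X)
    (v : X → E) : ℝ≥0∞ :=
  ∫⁻ x, ‖v x‖ₑ * ρ {x} ^ (α - 1) ∂ρ

theorem atomicEnergy_withDensity {X E : Type*} [MeasurableSpace X] [MeasurableSingletonClass X]
    [NormedAddCommGroup E] {α : ℝ} (hα : 0 < α) {ρ : Measure X} [IsFiniteMeasure ρ] {v : X → E}
    (hv : ∀ x, ρ {x} = 0 → v x = 0) :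
    atomicEnergy α (ρ.withDensity fun x => ‖v x‖ₑ ^ (1 / α)) = atomicCost α ρ v := by
  set a := {x | ρ {x} ≠ 0} with ha
  have hac : a.Countable := countable_setOf_measure_singleton_ne_zero ρ
  have ham := hac.measurableSet
  have hva : ∀ x ∈ aᶜ, v x = 0 := fun x hx => hv x (by simpa [ha] using hx)
  have hα' : 0 < 1 / α := by positivity
  have hatom : IsPurelyAtomic (ρ.withDensity fun x => ‖v x‖ₑ ^ (1 / α)) := by
    refine ⟨a, hac, ?_⟩
    rw [withDensity_apply _ ham.compl, setLIntegral_congr_fun ham.compl (g := fun _ => 0)]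
    · simp
    · intro x hx
      simp [hva x hx, hα]
  rw [atomicEnergy, if_pos hatom, atomicCost, ← lintegral_add_compl _ ham,
    lintegral_countable _ hac, setLIntegral_congr_fun ham.compl (g := fun _ => 0)]
  · rw [lintegral_zero, add_zero, ← tsum_subtype_eq_of_support_subset (s := a)]
    · refine tsum_congr fun x => ?_
      have hx : ρ {(x : X)} ≠ 0 := x.2
      rw [withDensity_apply _ (measurableSet_singleton _), Measure.restrict_singleton,
        lintegral_smul_measure, lintegral_dirac, smul_eq_mul, ENNReal.mul_rpow_of_nonneg _ _ hα.le,
        ← ENNReal.rpow_mul, one_div_mul_cancel hα.ne', ENNReal.rpow_one, mul_comm, mul_assoc]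
      congr 1
      rw [ENNReal.rpow_sub _ _ hx (measure_ne_top _ _), ENNReal.rpow_one,
        ENNReal.div_mul_cancel hx (measure_ne_top _ _)]
    · intro x hx
      by_contra hxa
      refine hx ?_
      dsimp only
      rw [withDensity_apply _ (measurableSet_singleton _), Measure.restrict_singleton,
        lintegral_smul_measure, lintegral_dirac, hva x hxa]
      simp [hα]
  -- Off the atoms the weight `0 ^ (α - 1)` is `⊤`, but `v` vanishes there and `0 * ⊤ = 0`.
  · intro x hx
    simp [hva x hx]

/-- The weight `ρ {x} ^ (α - 1)` is a negative power of a number at most `1`, hence at least `1`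
(and `⊤` off the atoms). Bounds on the cost thus become bounds on the mass of the momentum. -/
theorem lintegral_enorm_le_atomicCost {X E : Type*} [MeasurableSpace X] [NormedAddCommGroup E]
    {α : ℝ} (hα : α < 1) {ρ : Measure X} [IsProbabilityMeasure ρ] (v : X → E) :
    ∫⁻ x, ‖v x‖ₑ ∂ρ ≤ atomicCost α ρ v := by
  refine lintegral_mono fun x => ?_
  calc ‖v x‖ₑ = ‖v x‖ₑ * 1 := (mul_one _).symm
    _ ≤ ‖v x‖ₑ * ρ {x} ^ (α - 1) := by
      gcongr
      rcases eq_or_ne (ρ {x}) 0 with hx | hx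
      · rw [hx, ENNReal.zero_rpow_of_neg (by linarith)]
        exact le_top
      · exact ENNReal.one_le_rpow_of_pos_of_le_one_of_neg (pos_iff_ne_zero.2 hx) prob_le_one
          (by linarith)



/-- The density `q({x}) / ρ({x})` of `q` with respect to `ρ` on the atoms of `ρ`, and `0`
elsewhere. -/
def atomicVelocity {X E : Type*} [MeasurableSpace X] [NormedAddCommGroup E] [NormedSpace ℝ E]
    (ρ : Measure X) (q : VectorMeasure X E) (x : X) : E :=
  (ρ {x}).toReal⁻¹ • q {x}

theorem atomicVelocity_eq_zero {X E : Type*} [MeasurableSpace X] [NormedAddCommGroup E]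
    [NormedSpace ℝ E] {ρ : Measure X} (q : VectorMeasure X E) {x : X} (hx : ρ {x} = 0) :
    atomicVelocity ρ q x = 0 := by
  simp [atomicVelocity, hx]

theorem atomicVelocity_smul {X E : Type*} [MeasurableSpace X] [NormedAddCommGroup E]
    [NormedSpace ℝ E] (ρ : Measure X) (q : VectorMeasure X E) (c : ℝ) :
    atomicVelocity ρ (c • q) = c • atomicVelocity ρ q := by
  ext1 x
  simp [atomicVelocity, smul_comm c]

/-- If `|v|^(1/α) ρ` lives on a countable set `s`, then `v = 0` almost everywhere outside `s`, while
the points of `s` that are not atoms of `ρ` form a countable null set. Only the values at atoms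
remain, and these are read off from `q {x}`. -/
theorem ae_eq_atomicVelocity {X E : Type*} [MeasurableSpace X] [MeasurableSingletonClass X]
    [NormedAddCommGroup E] [NormedSpace ℝ E] [CompleteSpace E] {α : ℝ} (hα : 0 < α)
    {ρ : Measure X} [IsFiniteMeasure ρ] {v : X → E} (hv : Integrable v ρ)
    (hat : IsPurelyAtomic (ρ.withDensity fun x => ‖v x‖ₑ ^ (1 / α))) :
    v =ᵐ[ρ] atomicVelocity ρ (ρ.withDensityᵥ v) := by
  have hval : ∀ x, ρ {x} ≠ 0 → atomicVelocity ρ (ρ.withDensityᵥ v) x = v x := by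
    intro x hx
    have : (ρ {x}).toReal ≠ 0 := (ENNReal.toReal_pos hx (measure_ne_top _ _)).ne'
    rw [atomicVelocity, withDensityᵥ_apply hv (measurableSet_singleton x), integral_singleton,
      Measure.real, smul_smul, inv_mul_cancel₀ this, one_smul]
  obtain ⟨s, hs, hs0⟩ := hat
  have hsm := hs.measurableSet
  rw [withDensity_apply _ hsm.compl, lintegral_eq_zero_iff' (by
    exact (hv.aestronglyMeasurable.restrict.enorm.pow_const _)),
    EventuallyEq, ae_restrict_iff' hsm.compl] at hs0
  have hnull : ρ (s ∩ {x | ρ {x} = 0}) = 0 := by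
    have hc : (s ∩ {x | ρ {x} = 0}).Countable := hs.mono Set.inter_subset_left
    rw [← Set.biUnion_of_singleton (s ∩ {x | ρ {x} = 0}), measure_biUnion_null_iff hc]
    exact fun x hx => hx.2
  filter_upwards [hs0, measure_eq_zero_iff_ae_notMem.1 hnull] with x h1 h2
  by_cases hx : ρ {x} = 0
  · have : x ∈ sᶜ := fun hxs => h2 ⟨hxs, hx⟩
    have := h1 this
    rw [atomicVelocity_eq_zero _ hx]
    simpa [hα, hα.not_gt] using this
  · exact (hval x hx).symm

-- Every competitor of finite energy agrees almost everywhere with `atomicVelocity`, so the infimum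
-- has an explicit candidate. This form makes the dependence on time measurable.
open Classical in
theorem momentumCost_eq {α : ℝ} (hα : 0 < α) {ρ : Measure Ω} [IsFiniteMeasure ρ]
    (q : VectorMeasure Ω (EuclideanSpace ℝ (Fin d))) :
    momentumCost α ρ q =
      if Integrable (atomicVelocity ρ q) ρ ∧ q = ρ.withDensityᵥ (atomicVelocity ρ q) then
        atomicCost α ρ (atomicVelocity ρ q) else ⊤ := by
  have hE := atomicEnergy_withDensity hα (v := atomicVelocity ρ q)
    (fun x hx => atomicVelocity_eq_zero (ρ := ρ) q hx)
  apply le_antisymm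
  · split_ifs with h
    · rw [← hE]
      exact iInf₂_le (f := fun v (_ : Integrable v ρ ∧ q = ρ.withDensityᵥ v) =>
        atomicEnergy α (ρ.withDensity fun x => ‖v x‖ₑ ^ (1 / α))) _ h
    · exact le_top
  · refine le_iInf₂ fun v hv => ?_
    by_cases hat : IsPurelyAtomic (ρ.withDensity fun x => ‖v x‖ₑ ^ (1 / α))
    · have hae := ae_eq_atomicVelocity hα hv.1 hat
      rw [← hv.2] at hae
      rw [if_pos ⟨hv.1.congr hae, hv.2.trans (WithDensityᵥEq.congr_ae hae)⟩, ← hE]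
      refine le_of_eq (congrArg _ (withDensity_congr_ae ?_))
      filter_upwards [hae] with x hx
      rw [hx]
    · rw [atomicEnergy, if_neg hat]
      exact le_top

theorem momentumCost_of_ne_top {α : ℝ} (hα : 0 < α) {ρ : Measure Ω} [IsFiniteMeasure ρ]
    {q : VectorMeasure Ω (EuclideanSpace ℝ (Fin d))} (h : momentumCost α ρ q ≠ ⊤) :
    Integrable (atomicVelocity ρ q) ρ ∧ q = ρ.withDensityᵥ (atomicVelocity ρ q) ∧
      momentumCost α ρ q = atomicCost α ρ (atomicVelocity ρ q) := by
  have := momentumCost_eq hα (ρ := ρ) q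
  split_ifs at this with h'
  · exact ⟨h'.1, h'.2, this⟩
  · exact absurd this h

/-- The exponents `1/α` and `α` cancel, so the cost scales linearly with the momentum; this is what
a time change exploits. -/
theorem momentumCost_smul_le {α : ℝ} (hα : 0 < α) {ρ : Measure Ω} [IsFiniteMeasure ρ]
    {q : VectorMeasure Ω (EuclideanSpace ℝ (Fin d))} (h : momentumCost α ρ q ≠ ⊤) (c : ℝ) :
    momentumCost α ρ (c • q) ≤ ‖c‖ₑ * momentumCost α ρ q := by
  obtain ⟨h1, h2, h3⟩ := momentumCost_of_ne_top hα h
  have h4 : Integrable (atomicVelocity ρ (c • q)) ρ ∧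
      c • q = ρ.withDensityᵥ (atomicVelocity ρ (c • q)) := by
    rw [atomicVelocity_smul]
    refine ⟨h1.smul c, ?_⟩
    rw [withDensityᵥ_smul, ← h2]
  rw [h3, momentumCost_eq hα, if_pos h4, atomicVelocity_smul, atomicCost, atomicCost,
    ← lintegral_const_mul' _ _ enorm_ne_top]
  refine le_of_eq (lintegral_congr fun x => ?_)
  rw [Pi.smul_apply, enorm_smul, mul_assoc]

theorem momentumCost_zero {α : ℝ} (hα : 0 < α) (ρ : Measure Ω) [IsFiniteMeasure ρ] :
    momentumCost α ρ 0 = 0 := by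
  have h0 : atomicVelocity ρ (0 : VectorMeasure Ω (EuclideanSpace ℝ (Fin d))) = 0 := by
    ext1 x
    simp [atomicVelocity]
  rw [momentumCost_eq hα, h0, if_pos ⟨integrable_zero _ _ _, by simp⟩]
  simp [atomicCost]

/-! ### Measurability in time of measures, velocities and costs -/

/-- Closed sets form a generating π-system, and the mass of a closed set is a pointwise limit of
integrals of bounded continuous functions, which are continuous in `t`. -/
theorem measurable_toMeasure_of_continuous {T X : Type*} [TopologicalSpace T] [MeasurableSpace T]
    [OpensMeasurableSpace T] [TopologicalSpace X] [MeasurableSpace X] [BorelSpace X]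
    [HasOuterApproxClosed X] {ρ : T → ProbabilityMeasure X} (hρ : Continuous ρ) :
    Measurable fun t => (ρ t : Measure X) := by
  refine Measurable.measure_of_isPiSystem_of_isProbabilityMeasure
    ((‹BorelSpace X›.measurable_eq).trans borel_eq_generateFrom_isClosed) isPiSystem_isClosed ?_
  intro F hF
  have hF : IsClosed F := hF
  refine measurable_of_tendsto_metrizable (f := fun n t => ∫⁻ x, hF.apprSeq n x ∂(ρ t : Measure X))
    (fun n => ?_) (tendsto_pi_nhds.2 fun t => HasOuterApproxClosed.tendsto_lintegral_apprSeq hF _)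
  refine Continuous.measurable ?_
  exact ProbabilityMeasure.continuous_iff_forall_continuous_lintegral.1 hρ _

theorem antitone_countablePartitionSet {X : Type*} [MeasurableSpace X]
    [MeasurableSpace.CountablyGenerated X] (x : X) :
    Antitone fun n => MeasurableSpace.countablePartitionSet n x := by
  refine antitone_nat_of_succ_le fun n => ?_
  obtain ⟨S, hS, hS'⟩ := (MeasurableSpace.measurableSet_generateFrom_countablePartition_iff _ _).1
    (MeasurableSpace.measurableSet_succ_countablePartition n
      (MeasurableSpace.countablePartitionSet_mem n x))
  have hx := MeasurableSpace.mem_countablePartitionSet n x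
  rw [hS'] at hx ⊢
  obtain ⟨s, hs, hxs⟩ := hx
  rw [MeasurableSpace.countablePartitionSet_of_mem (hS hs) hxs]
  exact Set.subset_sUnion_of_mem hs

theorem iInter_countablePartitionSet {X : Type*} [MeasurableSpace X]
    [MeasurableSpace.CountablyGenerated X] [MeasurableSpace.SeparatesPoints X] (x : X) :
    ⋂ n, MeasurableSpace.countablePartitionSet n x = {x} := by
  refine Set.Subset.antisymm (fun y hy => ?_) (Set.singleton_subset_iff.2
    (Set.mem_iInter.2 fun n => MeasurableSpace.mem_countablePartitionSet n x))
  rw [Set.mem_iInter] at hy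
  have hg := MeasurableSpace.generateFrom_iUnion_countablePartition X
  have : @MeasurableSpace.SeparatesPoints X
      (MeasurableSpace.generateFrom (⋃ n, MeasurableSpace.countablePartition X n)) := by
    rw [hg]; infer_instance
  refine MeasurableSpace.separating_of_generateFrom
    (⋃ n, MeasurableSpace.countablePartition X n) y x fun s hs => ?_
  obtain ⟨n, hn⟩ := Set.mem_iUnion.1 hs
  rw [← MeasurableSpace.countablePartitionSet_eq_iff x hn,
    ← MeasurableSpace.countablePartitionSet_eq_iff y hn,
    MeasurableSpace.countablePartitionSet_of_mem (MeasurableSpace.countablePartitionSet_mem n x)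
      (hy n)]

theorem exists_countable_isPiSystem (X : Type*) [m : MeasurableSpace X]
    [MeasurableSpace.CountablyGenerated X] :
    ∃ C : Set (Set X), C.Countable ∧ IsPiSystem C ∧ Set.univ ∈ C ∧
      MeasurableSpace.generateFrom C = m ∧ ∀ s ∈ C, MeasurableSet s := by
  have hg : MeasurableSpace.generateFrom
      (generateSetAlgebra (MeasurableSpace.countableGeneratingSet X)) = m := by
    rw [generateFrom_generateSetAlgebra_eq,
      MeasurableSpace.generateFrom_countableGeneratingSet]
  refine ⟨generateSetAlgebra (MeasurableSpace.countableGeneratingSet X),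
    countable_generateSetAlgebra MeasurableSpace.countable_countableGeneratingSet,
    fun s hs t ht _ => isSetAlgebra_generateSetAlgebra.inter_mem hs ht,
    isSetAlgebra_generateSetAlgebra.univ_mem, hg, fun s hs => ?_⟩
  rw [← hg]
  exact MeasurableSpace.measurableSet_generateFrom hs

theorem vectorMeasure_ext_of_isPiSystem {X E : Type*} [m : MeasurableSpace X]
    [NormedAddCommGroup E] {C : Set (Set X)} (hC : IsPiSystem C) (huniv : Set.univ ∈ C)
    (hgen : MeasurableSpace.generateFrom C = m) {μ ν : VectorMeasure X E}
    (h : ∀ s ∈ C, μ s = ν s) : μ = ν := by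
  ext s hs
  induction s, hs using MeasurableSpace.induction_on_inter hgen.symm hC with
  | empty => simp
  | basic s hs => exact h s hs
  | compl s hs ih =>
    rw [VectorMeasure.of_compl hs, VectorMeasure.of_compl hs, ih, h _ huniv]
  | iUnion f hd hf ih =>
    rw [VectorMeasure.of_disjoint_iUnion hf hd, VectorMeasure.of_disjoint_iUnion hf hd]
    exact tsum_congr ih

/-- The exceptional null set in the hypothesis depends on `s`. A countable generating π-system gives
one null set for all its members, and setting the family to `0` there extends measurability to every
set by induction. -/
theorem exists_measurable_modification {T X E : Type*} [MeasurableSpace T] {μ : Measure T}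
    [m : MeasurableSpace X] [MeasurableSpace.CountablyGenerated X] [NormedAddCommGroup E]
    [MeasurableSpace E] [BorelSpace E] [SecondCountableTopology E] {q : T → VectorMeasure X E}
    (hq : ∀ s, MeasurableSet s → AEMeasurable (fun t => q t s) μ) :
    ∃ q' : T → VectorMeasure X E, (∀ᵐ t ∂μ, q' t = q t) ∧ ∀ s, Measurable fun t => q' t s := by
  classical
  obtain ⟨C, hCc, hCpi, hCuniv, hCgen, hCm⟩ := exists_countable_isPiSystem X
  have : Countable C := hCc.to_subtype
  have hae : ∀ᵐ t ∂μ, ∀ s : C, q t s = (hq s (hCm s s.2)).mk _ t :=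
    ae_all_iff.2 fun s => (hq s (hCm s s.2)).ae_eq_mk
  obtain ⟨G, hG, hGm, hGs⟩ := hae.exists_measurable_mem
  refine ⟨fun t => if t ∈ G then q t else 0, ?_, fun s => ?_⟩
  · filter_upwards [hG] with t ht
    rw [if_pos ht]
  by_cases hs : MeasurableSet s
  swap
  · simp [VectorMeasure.not_measurable _ hs]
  induction s, hs using MeasurableSpace.induction_on_inter hCgen.symm hCpi with
  | empty => simp
  | basic s hs =>
    have : (fun t => (if t ∈ G then q t else 0) s) = G.indicator ((hq s (hCm s hs)).mk _) := by
      ext1 t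
      by_cases ht : t ∈ G
      · simpa [ht] using hGs t ht ⟨s, hs⟩
      · simp [ht]
    rw [this]
    exact (hq s (hCm s hs)).measurable_mk.indicator hGm
  | compl s hs ih =>
    have huniv : Measurable fun t => (if t ∈ G then q t else 0) Set.univ := by
      have : (fun t => (if t ∈ G then q t else 0) Set.univ) =
          G.indicator ((hq _ (hCm _ hCuniv)).mk _) := by
        ext1 t
        by_cases ht : t ∈ G
        · simpa [ht] using hGs t ht ⟨_, hCuniv⟩
        · simp [ht]
      rw [this]
      exact (hq _ (hCm _ hCuniv)).measurable_mk.indicator hGm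
    simp_rw [VectorMeasure.of_compl hs]
    exact huniv.sub ih
  | iUnion f hd hf ih =>
    refine measurable_of_tendsto_metrizable
      (f := fun n t => ∑ i ∈ Finset.range n, (if t ∈ G then q t else 0) (f i))
      (fun n => Finset.measurable_fun_sum _ fun i _ => ih i) (tendsto_pi_nhds.2 fun t => ?_)
    exact (VectorMeasure.hasSum_of_disjoint_iUnion hf hd).tendsto_sum_nat

/-- A singleton is the decreasing intersection of its cells in the countable partitions; at each
level the mass of the cell containing `p.2` is a finite sum of measurable terms. -/
theorem measurable_apply_singleton {T X E : Type*} [MeasurableSpace T] [MeasurableSpace X]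
    [MeasurableSpace.CountablyGenerated X] [MeasurableSpace.SeparatesPoints X]
    [NormedAddCommGroup E] [MeasurableSpace E] [BorelSpace E] [SecondCountableTopology E]
    {q : T → VectorMeasure X E} (hq : ∀ s, Measurable fun t => q t s) :
    Measurable fun p : T × X => q p.1 {p.2} := by
  classical
  refine measurable_of_tendsto_metrizable
    (f := fun n p => q p.1 (MeasurableSpace.countablePartitionSet n p.2)) (fun n => ?_)
    (tendsto_pi_nhds.2 fun p => ?_)
  · have hfin := MeasurableSpace.finite_countablePartition X n
    have : (fun p : T × X => q p.1 (MeasurableSpace.countablePartitionSet n p.2)) =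
        fun p => ∑ s ∈ hfin.toFinset, if p.2 ∈ s then q p.1 s else 0 := by
      ext1 p
      rw [Finset.sum_eq_single_of_mem (MeasurableSpace.countablePartitionSet n p.2)
        (hfin.mem_toFinset.2 (MeasurableSpace.countablePartitionSet_mem n p.2)),
        if_pos (MeasurableSpace.mem_countablePartitionSet n p.2)]
      intro s hs hne
      rw [if_neg fun h => hne (MeasurableSpace.countablePartitionSet_of_mem
        (hfin.mem_toFinset.1 hs) h).symm]
    rw [this]
    refine Finset.measurable_fun_sum _ fun s hs => ?_
    exact Measurable.ite (measurable_snd (MeasurableSpace.measurableSet_countablePartition n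
      (hfin.mem_toFinset.1 hs))) ((hq s).comp measurable_fst) measurable_const
  · have := VectorMeasure.tendsto_vectorMeasure_iInter_atTop_nat (v := q p.1)
      (antitone_countablePartitionSet p.2)
      (fun n => MeasurableSpace.measurableSet_countablePartitionSet n p.2)
    rwa [iInter_countablePartitionSet] at this

theorem measurable_measure_singleton {T X : Type*} [MeasurableSpace T] [MeasurableSpace X]
    [MeasurableEq X] (κ : ProbabilityTheory.Kernel T X) [ProbabilityTheory.IsSFiniteKernel κ] :
    Measurable fun p : T × X => κ p.1 {p.2} := by
  have hs : MeasurableSet {p : (T × X) × X | p.2 = p.1.2} := by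
    exact measurableSet_eq_fun measurable_snd (measurable_snd.comp measurable_fst)
  exact ProbabilityTheory.Kernel.measurable_kernel_prodMk_left
    (κ := κ.comap Prod.fst measurable_fst) hs



/-- The identity `q = v ρ` between vector measures need only be tested on a countable π-system, so
the set of times where it holds is measurable. -/
theorem measurable_momentumCost {T : Type*} [MeasurableSpace T] {α : ℝ} (hα : 0 < α)
    (κ : ProbabilityTheory.Kernel T Ω) [ProbabilityTheory.IsMarkovKernel κ]
    {q : T → VectorMeasure Ω (EuclideanSpace ℝ (Fin d))} (hq : ∀ s, Measurable fun t => q t s) :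
    Measurable (fun p : T × Ω => atomicVelocity (κ p.1) (q p.1) p.2) ∧
      Measurable fun t => momentumCost α (κ t) (q t) := by
  classical
  have hκ := measurable_measure_singleton κ
  have hv : Measurable fun p : T × Ω => atomicVelocity (κ p.1) (q p.1) p.2 :=
    hκ.ennreal_toReal.inv.smul (measurable_apply_singleton hq)
  refine ⟨hv, ?_⟩
  simp_rw [momentumCost_eq hα]
  obtain ⟨C, hCc, hCpi, hCuniv, hCgen, hCm⟩ := exists_countable_isPiSystem Ω
  have : Countable C := hCc.to_subtype
  have hint : MeasurableSet {t | Integrable (atomicVelocity (κ t) (q t)) (κ t)} :=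
    ProbabilityTheory.measurableSet_kernel_integrable hv.stronglyMeasurable
  have heq : {t | Integrable (atomicVelocity (κ t) (q t)) (κ t) ∧
      q t = (κ t).withDensityᵥ (atomicVelocity (κ t) (q t))} =
      {t | Integrable (atomicVelocity (κ t) (q t)) (κ t)} ∩
      ⋂ s : C, {t | q t s = ∫ x, (s : Set Ω).indicator (atomicVelocity (κ t) (q t)) x ∂κ t} := by
    ext t
    simp only [Set.mem_ofPred_eq, Set.mem_inter_iff, Set.mem_iInter]
    refine and_congr_right fun hi => ⟨fun h s => ?_, fun h => ?_⟩
    · rw [integral_indicator (hCm s s.2), ← withDensityᵥ_apply hi (hCm s s.2), ← h]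
    · refine vectorMeasure_ext_of_isPiSystem hCpi hCuniv hCgen fun s hs => ?_
      rw [h ⟨s, hs⟩, integral_indicator (hCm s hs), withDensityᵥ_apply hi (hCm s hs)]
  refine Measurable.ite ?_ ?_ measurable_const
  · rw [heq]
    refine hint.inter (MeasurableSet.iInter fun s => measurableSet_eq_fun (hq s) ?_)
    refine StronglyMeasurable.measurable ?_
    refine StronglyMeasurable.integral_kernel_prod_right
      (f := fun t x => (s : Set Ω).indicator (atomicVelocity (κ t) (q t)) x) ?_
    have : Function.uncurry (fun t x => (s : Set Ω).indicator (atomicVelocity (κ t) (q t)) x) =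
        (Prod.snd ⁻¹' (s : Set Ω)).indicator
          fun p : T × Ω => atomicVelocity (κ p.1) (q p.1) p.2 := by
      ext1 p
      rfl
    rw [this]
    exact (hv.indicator (measurable_snd (hCm s s.2))).stronglyMeasurable
  · refine Measurable.lintegral_kernel_prod_right
      (f := fun t x => ‖atomicVelocity (κ t) (q t) x‖ₑ * κ t {x} ^ (α - 1)) ?_
    exact hv.enorm.mul (hκ.pow_const _)

/-- The velocity representation of a flow of finite cost. -/
theorem exists_velocity {α : ℝ} (hα : 0 < α) (hα' : α < 1) {f : Flow Ω}
    (hf : IsAdmissible f) {C : ℝ≥0} (hC : totalCost α f ≤ C) :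
    ∃ (v : I × Ω → EuclideanSpace ℝ (Fin d)) (h : I → ℝ≥0), Measurable v ∧ Measurable h ∧
      ∫⁻ t, h t ≤ C ∧ ∀ᵐ t, momentumCost α (f.rho t : Measure Ω) (f.mom t) ≤ h t ∧
        Integrable (fun x => v (t, x)) (f.rho t : Measure Ω) ∧
        f.mom t = (f.rho t : Measure Ω).withDensityᵥ (fun x => v (t, x)) ∧
        ∫⁻ x, ‖v (t, x)‖ₑ ∂(f.rho t : Measure Ω) ≤ h t := by
  obtain ⟨q, hqf, hq⟩ := exists_measurable_modification hf.memL1_mom.1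
  let κ : ProbabilityTheory.Kernel I Ω :=
    ⟨fun t => (f.rho t : Measure Ω), measurable_toMeasure_of_continuous hf.continuous_rho⟩
  have hκ : ProbabilityTheory.IsMarkovKernel κ := ⟨fun t => by
    change IsProbabilityMeasure (f.rho t : Measure Ω)
    infer_instance⟩
  obtain ⟨hv, hF⟩ := measurable_momentumCost hα κ hq
  have hle : ∫⁻ t, momentumCost α (κ t) (q t) ≤ C := by
    refine le_trans (le_of_eq (lintegral_congr_ae ?_)) hC
    filter_upwards [hqf] with t ht
    rw [ht]
    rfl
  have hfin : ∀ᵐ t, momentumCost α (κ t) (q t) < ⊤ :=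
    ae_lt_top hF (hle.trans_lt ENNReal.coe_lt_top).ne
  refine ⟨fun p => atomicVelocity (κ p.1) (q p.1) p.2,
    fun t => (momentumCost α (κ t) (q t)).toNNReal, hv, hF.ennreal_toNNReal, ?_, ?_⟩
  · exact (lintegral_mono fun t => ENNReal.coe_toNNReal_le_self).trans hle
  · filter_upwards [hqf, hfin] with t ht1 ht2
    obtain ⟨h1, h2, h3⟩ := momentumCost_of_ne_top hα ht2.ne
    rw [ENNReal.coe_toNNReal ht2.ne]
    refine ⟨?_, h1, ?_, ?_⟩
    · rw [ht1]; rfl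
    · rw [← ht1]; exact h2
    · rw [h3]; exact lintegral_enorm_le_atomicCost hα' (ρ := κ t) _

/-! ### Change of the time variable -/

theorem integral_unitInterval {E : Type*} [NormedAddCommGroup E] [NormedSpace ℝ E] (g : ℝ → E) :
    ∫ t : I, g t = ∫ r in (0 : ℝ)..1, g r := by
  rw [unitInterval.measurePreserving_coe.integral_comp unitInterval.measurableEmbedding_coe,
    intervalIntegral.integral_of_le zero_le_one, integral_Icc_eq_integral_Ioc]

theorem setIntegral_Iic_unitInterval {E : Type*} [NormedAddCommGroup E] [NormedSpace ℝ E]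
    (g : ℝ → E) (a : I) : ∫ t in Set.Iic a, g t = ∫ r in (0 : ℝ)..a, g r := by
  rw [← integral_indicator measurableSet_Iic]
  have : (Set.Iic a).indicator (fun t : I => g t) =
      fun t : I => (Set.Iic (a : ℝ)).indicator g t := by
    ext1 t
    by_cases h : t ≤ a
    · rw [Set.indicator_of_mem (by exact h), Set.indicator_of_mem (by exact h)]
    · rw [Set.indicator_of_notMem (by exact h), Set.indicator_of_notMem (by exact h)]
  rw [this, unitInterval.measurePreserving_coe.integral_comp unitInterval.measurableEmbedding_coe,
    integral_indicator measurableSet_Iic, Measure.restrict_restrict measurableSet_Iic,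
    intervalIntegral.integral_of_le a.2.1, ← integral_Icc_eq_integral_Ioc]
  congr 2
  ext r
  exact ⟨fun h => ⟨h.2.1, h.1⟩, fun h => ⟨h.2, h.1, h.2.trans a.2.2⟩⟩

theorem ae_unitInterval {p : ℝ → Prop} (h : ∀ᵐ r, r ∈ Set.Icc (0 : ℝ) 1 → p r) :
    ∀ᵐ t : I, p t := by
  have h2 : ∀ᵐ r ∂(volume.restrict I), p r := (ae_restrict_iff' measurableSet_Icc).2 h
  exact unitInterval.measurePreserving_coe.quasiMeasurePreserving.ae h2

theorem intervalIntegrable_iff_unitInterval {E : Type*} [NormedAddCommGroup E] {g : ℝ → E} :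
    IntervalIntegrable g volume 0 1 ↔ Integrable fun t : I => g t := by
  rw [intervalIntegrable_iff_integrableOn_Icc_of_le zero_le_one, IntegrableOn]
  exact (unitInterval.measurePreserving_coe.integrable_comp_emb
    unitInterval.measurableEmbedding_coe).symm

theorem AbsolutelyContinuousOnInterval.congr {f g : ℝ → ℝ} {a b : ℝ}
    (hf : AbsolutelyContinuousOnInterval f a b) (h : Set.EqOn f g (Set.uIcc a b)) :
    AbsolutelyContinuousOnInterval g a b := by
  rw [absolutelyContinuousOnInterval_iff] at hf ⊢
  intro ε hε
  obtain ⟨δ, hδ, H⟩ := hf ε hε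
  refine ⟨δ, hδ, fun E hE hlt => ?_⟩
  convert H E hE hlt using 1
  refine Finset.sum_congr rfl fun i hi => ?_
  have := hE.1 i hi
  rw [h this.1, h this.2]

/-- A change of the time variable with prescribed density. -/
theorem exists_timeChange {h : I → ℝ≥0} (hm : Measurable h) {C : ℝ≥0} (hC : ∫⁻ t, h t ≤ C) :
    ∃ (φ : I ≃o I) (k : I → ℝ), AbsolutelyContinuousOnInterval (timeExtend φ) 0 1 ∧
      AbsolutelyContinuousOnInterval (timeExtend φ.symm) 0 1 ∧ Measurable k ∧ (∀ t, 0 < k t) ∧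
      (∀ t, (k t)⁻¹ * h t ≤ 1 + C) ∧
      Measure.map φ volume = volume.withDensity (fun t => ENNReal.ofReal (k t)) ∧
      ∀ᵐ t : I, deriv (timeExtend φ) t = (k (φ t))⁻¹ := by
  have hfin : ∫⁻ t, (h t : ℝ≥0∞) ≠ ⊤ := (hC.trans_lt ENNReal.coe_lt_top).ne
  have hi : Integrable fun t => (h t : ℝ) := by
    refine ⟨hm.coe_nnreal_real.aestronglyMeasurable, ?_⟩
    rw [hasFiniteIntegral_iff_enorm]
    simpa using! hfin.lt_top
  set A : ℝ := ∫ t, (h t : ℝ) with hA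
  have hA0 : 0 ≤ A := integral_nonneg fun t => (h t).2
  have hAC : A ≤ C := by
    rw [hA, integral_eq_lintegral_of_nonneg_ae (f := fun t => (h t : ℝ))
      (ae_of_all _ fun t => (h t).2) hi.1]
    refine ENNReal.toReal_le_coe_of_le_coe ?_
    simpa using hC
  -- The density is `k = (1 + h) / c`. The summand `1` keeps `k ≥ 1/c`, so the inverse of its
  -- primitive `S` is `c`-Lipschitz; dividing by `c` gives `k` total mass `1`. Then `h / k = c h /
  -- (1 + h) ≤ c ≤ 1 + C`. The time change is `φ = S⁻¹`.
  set c : ℝ := 1 + A with hc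
  have hc0 : 0 < c := by positivity
  set k : I → ℝ := fun t => (1 + h t) / c with hk
  have hkm : Measurable k := (measurable_const.add hm.coe_nnreal_real).div_const c
  have hkc : ∀ t, c⁻¹ ≤ k t := fun t => by
    change c⁻¹ ≤ (1 + (h t : ℝ)) / c
    rw [inv_eq_one_div]
    exact div_le_div_of_nonneg_right (le_add_of_nonneg_right (h t).2) hc0.le
  have hk0 : ∀ t, 0 < k t := fun t => (inv_pos.2 hc0).trans_le (hkc t)
  have hki : Integrable k := ((integrable_const _).add hi).div_const c
  have hk1 : ∫ t, k t = 1 := by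
    rw [hk, integral_div, integral_add (integrable_const _) hi]
    simp only [integral_const, probReal_univ, smul_eq_mul, mul_one]
    exact div_self hc0.ne'
  set K : ℝ → ℝ := Set.IccExtend (zero_le_one : (0 : ℝ) ≤ 1) k with hK
  have hKk : ∀ t : I, K t = k t := fun t => Set.IccExtend_val _ _ t
  have hKi : IntervalIntegrable K volume 0 1 := by
    rw [intervalIntegrable_iff_unitInterval]
    simpa only [hKk] using hki
  set S : ℝ → ℝ := fun r => ∫ x in (0 : ℝ)..r, K x with hS
  have hS0 : S 0 = 0 := by simp [hS]
  have hS1 : S 1 = 1 := by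
    refine Eq.trans ?_ hk1
    simp only [hS, ← hKk, integral_unitInterval K]
  have hsub : ∀ a b : I, IntervalIntegrable K volume a b := fun a b =>
    hKi.mono_set (by
      rw [Set.uIcc_of_le (zero_le_one : (0 : ℝ) ≤ 1)]
      exact Set.uIcc_subset_Icc a.2 b.2)
  have hincr : ∀ a b : I, a ≤ b → c⁻¹ * ((b : ℝ) - a) ≤ S b - S a := by
    intro a b hab
    have h1 : S b - S a = ∫ x in (a : ℝ)..b, K x :=
      intervalIntegral.integral_interval_sub_left (hsub 0 b) (hsub 0 a)
    have h2 : ∫ x in (a : ℝ)..b, c⁻¹ = c⁻¹ * ((b : ℝ) - a) := by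
      rw [intervalIntegral.integral_const, smul_eq_mul, mul_comm]
    rw [h1, ← h2]
    exact intervalIntegral.integral_mono_on hab intervalIntegrable_const (hsub a b)
      fun x _ => hkc _
  have hSac : AbsolutelyContinuousOnInterval S 0 1 :=
    hKi.absolutelyContinuousOnInterval_intervalIntegral (by simp)
  have hScont : ContinuousOn S (Set.Icc 0 1) := by
    simpa [Set.uIcc_of_le (zero_le_one : (0 : ℝ) ≤ 1)] using hSac.continuousOn
  have hSmono : ∀ a b : I, a < b → S a < S b := fun a b hab => by
    have h1 := hincr a b hab.le
    have h2 : 0 < c⁻¹ * ((b : ℝ) - a) := mul_pos (inv_pos.2 hc0) (sub_pos.2 hab)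
    linarith
  have hSmono' : ∀ a b : I, a ≤ b → S a ≤ S b := fun a b hab => by
    rcases hab.eq_or_lt with rfl | h
    · rfl
    · exact (hSmono a b h).le
  have hSmem : ∀ t : I, S t ∈ I := fun t => by
    constructor
    · have := hSmono' 0 t t.2.1
      rwa [Set.Icc.coe_zero, hS0] at this
    · have := hSmono' t 1 t.2.2
      rwa [Set.Icc.coe_one, hS1] at this
  have hsm : StrictMono fun t : I => (⟨S t, hSmem t⟩ : I) := fun a b hab => hSmono a b hab
  have hsurj : Function.Surjective fun t : I => (⟨S t, hSmem t⟩ : I) := by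
    intro y
    have := intermediate_value_Icc zero_le_one hScont
    rw [hS0, hS1] at this
    obtain ⟨x, hx, hxy⟩ := this y.2
    exact ⟨⟨x, hx⟩, Subtype.ext hxy⟩
  set e : I ≃o I := StrictMono.orderIsoOfSurjective _ hsm hsurj with he
  have heS : ∀ t : I, ((e t : I) : ℝ) = S t := fun t => rfl
  have hφS : ∀ t : I, S (e.symm t : I) = t := fun t => by
    rw [← heS, OrderIso.apply_symm_apply]
  have hφ : ∀ t : I, timeExtend e.symm t = e.symm t := fun t => Set.IccExtend_val _ _ t
  have hlip : LipschitzOnWith c.toNNReal (timeExtend e.symm) (Set.uIcc 0 1) := by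
    rw [Set.uIcc_of_le zero_le_one]
    refine LipschitzOnWith.of_dist_le_mul fun x hx y hy => ?_
    lift x to I using hx
    lift y to I using hy
    rw [hφ, hφ, Real.coe_toNNReal _ hc0.le]
    wlog hxy : x ≤ y generalizing x y
    · rw [dist_comm, dist_comm (x : ℝ)]
      exact this y x (le_of_not_ge hxy)
    have h1 := hincr _ _ (e.symm.monotone hxy)
    rw [hφS, hφS, inv_mul_le_iff₀ hc0] at h1
    rw [dist_comm, dist_comm (x : ℝ), Real.dist_eq, Real.dist_eq,
      abs_of_nonneg (sub_nonneg.2 (by exact e.symm.monotone hxy)),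
      abs_of_nonneg (sub_nonneg.2 (by exact hxy))]
    exact h1
  have hmap : Measure.map e.symm volume = volume.withDensity fun t => ENNReal.ofReal (k t) := by
    have hφm : Measurable e.symm := e.symm.continuous.measurable
    have : IsFiniteMeasure (Measure.map e.symm (volume : Measure I)) :=
      (volume : Measure I).isFiniteMeasure_map _
    -- Half-lines suffice: the preimage of `Iic a` is `Iic (S a)`, of length `S a = ∫₀ᵃ k`.
    refine Measure.ext_of_Iic _ _ fun a => ?_
    rw [Measure.map_apply hφm measurableSet_Iic, withDensity_apply _ measurableSet_Iic]
    have h1 : e.symm ⁻¹' Set.Iic a = Set.Iic (e a) := by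
      ext t
      exact e.symm_apply_le
    rw [h1, unitInterval.volume_Iic, heS, ← ofReal_integral_eq_lintegral_ofReal hki.integrableOn
      (ae_of_all _ fun t => (hk0 t).le), hS]
    dsimp only
    rw [← setIntegral_Iic_unitInterval]
    simp only [hKk]
  refine ⟨e.symm, k, hlip.absolutelyContinuousOnInterval, ?_, hkm, hk0, ?_, hmap, ?_⟩
  · refine AbsolutelyContinuousOnInterval.congr hSac fun r hr => ?_
    rw [Set.uIcc_of_le zero_le_one] at hr
    lift r to I using hr
    rw [timeExtend, Set.IccExtend_val]
    rfl
  · intro t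
    have h0 : 0 < 1 + (h t : ℝ) := by have := (h t).2; positivity
    calc (k t)⁻¹ * h t = c * (h t / (1 + h t)) := by rw [hk]; field_simp
      _ ≤ c * 1 := by
        gcongr
        rw [div_le_one h0]
        linarith
      _ ≤ 1 + C := by rw [mul_one, hc]; gcongr
  · have h1 : ∀ᵐ t : I, HasDerivAt S (k t) t := by
      have := ae_unitInterval (p := fun r => HasDerivAt S (K r) r) (by
        filter_upwards [hKi.ae_hasDerivAt_integral] with r hr hr'
        rw [← Set.uIcc_of_le zero_le_one] at hr'
        exact hr hr' 0 (by simp))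
      simpa only [hKk] using this
    -- The times where `S` has no derivative `k` form a null set, whose preimage under `φ` is null
    -- because the image of Lebesgue measure under `φ` has a density.
    have h2 : ∀ᵐ t : I, HasDerivAt S (k (e.symm t)) (e.symm t : I) := by
      have hac : Measure.map e.symm volume ≪ volume := by
        rw [hmap]
        exact withDensity_absolutelyContinuous _ _
      exact ae_of_ae_map e.symm.continuous.aemeasurable (hac.ae_le h1)
    have h3 : ∀ᵐ t : I, t ≠ 0 := by simp [ae_iff, measure_singleton]
    have h4 : ∀ᵐ t : I, t ≠ 1 := by simp [ae_iff, measure_singleton]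
    filter_upwards [h2, h3, h4] with t h2 h3 h4
    have ht : (t : ℝ) ∈ Set.Ioo (0 : ℝ) 1 :=
      ⟨lt_of_le_of_ne t.2.1 fun h => h3 (Subtype.ext h.symm),
        lt_of_le_of_ne t.2.2 fun h => h4 (Subtype.ext h)⟩
    have hcont : Continuous (timeExtend e.symm) :=
      (continuous_subtype_val.comp e.symm.continuous).Icc_extend'
    refine (HasDerivAt.of_local_left_inverse (f := S) hcont.continuousAt
      (by rw [hφ]; exact h2) (hk0 _).ne' ?_).deriv
    filter_upwards [isOpen_Ioo.mem_nhds ht] with y hy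
    have hy' : y ∈ I := Set.Ioo_subset_Icc_self hy
    lift y to I using hy'
    rw [hφ, hφS]

/-! ### The continuity equation for momenta with a density -/

/-- A weakly continuous curve of probability measures, seen as a Markov kernel. -/
def curveKernel {X : Type*} [TopologicalSpace X] [MeasurableSpace X] [BorelSpace X]
    [HasOuterApproxClosed X] {ρ : I → ProbabilityMeasure X} (hρ : Continuous ρ) :
    ProbabilityTheory.Kernel I X :=
  ⟨fun t => (ρ t : Measure X), measurable_toMeasure_of_continuous hρ⟩

theorem curveKernel_apply {X : Type*} [TopologicalSpace X] [MeasurableSpace X] [BorelSpace X]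
    [HasOuterApproxClosed X] {ρ : I → ProbabilityMeasure X} (hρ : Continuous ρ) (t : I) :
    curveKernel hρ t = (ρ t : Measure X) := rfl

instance {X : Type*} [TopologicalSpace X] [MeasurableSpace X] [BorelSpace X]
    [HasOuterApproxClosed X] {ρ : I → ProbabilityMeasure X} (hρ : Continuous ρ) :
    ProbabilityTheory.IsMarkovKernel (curveKernel hρ) :=
  ⟨fun t => by rw [curveKernel_apply]; infer_instance⟩

/-- The momentum of `f` is `v(t,·) η_t` for almost every `t`. -/
structure HasDensity (f : Flow Ω) (η : ProbabilityTheory.Kernel I Ω)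
    (v : I × Ω → EuclideanSpace ℝ (Fin d)) : Prop where
  measurable : Measurable v
  integrable : Integrable v (volume.compProd η)
  ae_mom : ∀ᵐ t, f.mom t = (η t).withDensityᵥ fun x => v (t, x)

theorem ae_integrable_of_compProd {T X E : Type*} [MeasurableSpace T] [MeasurableSpace X]
    [NormedAddCommGroup E] {μ : Measure T} [SFinite μ] {η : ProbabilityTheory.Kernel T X}
    [ProbabilityTheory.IsSFiniteKernel η] {v : T × X → E} (hv : Integrable v (μ.compProd η)) :
    ∀ᵐ t ∂μ, Integrable (fun x => v (t, x)) (η t) :=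
  ((Measure.integrable_compProd_iff hv.1).1 hv).1

theorem integrable_integral_compProd {T X E : Type*} [MeasurableSpace T] [MeasurableSpace X]
    [NormedAddCommGroup E] [NormedSpace ℝ E] {μ : Measure T} [SFinite μ]
    {η : ProbabilityTheory.Kernel T X} [ProbabilityTheory.IsSFiniteKernel η] {v : T × X → E}
    (hv : Integrable v (μ.compProd η)) : Integrable (fun t => ∫ x, v (t, x) ∂η t) μ := by
  have h2 := ((Measure.integrable_compProd_iff hv.1).1 hv).2
  refine h2.mono' ?_ (ae_of_all _ fun t => norm_integral_le_integral_norm _)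
  exact hv.1.integral_kernel_compProd

theorem HasDensity.memL1 {f : Flow Ω} {η : ProbabilityTheory.Kernel I Ω}
    [ProbabilityTheory.IsMarkovKernel η] {v : I × Ω → EuclideanSpace ℝ (Fin d)}
    (h : HasDensity f η v) : MemL1 f.mom := by
  have hi := ae_integrable_of_compProd h.integrable
  constructor
  · intro A hA
    refine ⟨fun t => ∫ x, A.indicator (fun x => v (t, x)) x ∂η t, ?_, ?_⟩
    · refine StronglyMeasurable.measurable ?_
      refine StronglyMeasurable.integral_kernel_prod_right
        (f := fun t x => A.indicator (fun x => v (t, x)) x) ?_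
      exact (h.measurable.indicator (measurable_snd hA)).stronglyMeasurable
    · filter_upwards [hi, h.ae_mom] with t h1 h2
      rw [h2, withDensityᵥ_apply h1 hA, integral_indicator hA]
  · have h1 : ∫⁻ t, (f.mom t).variation Set.univ = ∫⁻ t, ∫⁻ x, ‖v (t, x)‖ₑ ∂η t := by
      refine lintegral_congr_ae ?_
      filter_upwards [hi, h.ae_mom] with t h1 h2
      rw [h2, Measure.variation_withDensityᵥ h1, withDensity_apply _ MeasurableSet.univ,
        Measure.restrict_univ]
    rw [h1, ← Measure.lintegral_compProd h.measurable.enorm]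
    exact h.integrable.2

theorem HasDensity.integrable_pairing {f : Flow Ω} {η : ProbabilityTheory.Kernel I Ω}
    [ProbabilityTheory.IsMarkovKernel η] {v : I × Ω → EuclideanSpace ℝ (Fin d)}
    (h : HasDensity f η v) {Ψ : I × Ω → EuclideanSpace ℝ (Fin d)} (hΨ : Measurable Ψ) {C : ℝ}
    (hC : ∀ p, ‖Ψ p‖ ≤ C) :
    Integrable (fun t => pairing (f.mom t) fun x => Ψ (t, x)) ∧
      ∫ t, pairing (f.mom t) (fun x => Ψ (t, x)) =
        ∫ p, inner ℝ (Ψ p) (v p) ∂(volume.compProd η) := by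
  have hi := ae_integrable_of_compProd h.integrable
  have h1 : (fun t => pairing (f.mom t) fun x => Ψ (t, x)) =ᵐ[volume]
      fun t => ∫ x, inner ℝ (Ψ (t, x)) (v (t, x)) ∂η t := by
    filter_upwards [hi, h.ae_mom] with t h1 h2
    rw [h2, pairing]
    exact integral_withDensityᵥ h1 (hΨ.comp measurable_prodMk_left).stronglyMeasurable
      fun x => hC (t, x)
  have h2 : Integrable (fun p => inner ℝ (Ψ p) (v p)) (volume.compProd η) :=
    integrable_inner_of_bound h.integrable hΨ.aestronglyMeasurable hC
  refine ⟨(integrable_integral_compProd h2).congr h1.symm, ?_⟩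
  rw [integral_congr_ae h1, Measure.integral_compProd h2]

theorem deriv_time_eq {φ : ℝ × EuclideanSpace ℝ (Fin d) → ℝ} {t : ℝ}
    {x : EuclideanSpace ℝ (Fin d)} (hφ : DifferentiableAt ℝ φ (t, x)) :
    deriv (fun s : ℝ => φ (s, x)) t = fderiv ℝ φ (t, x) (1, 0) := by
  have h1 : HasDerivAt (fun s : ℝ => (s, x)) ((1 : ℝ), (0 : EuclideanSpace ℝ (Fin d))) t :=
    (hasDerivAt_id t).prodMk (hasDerivAt_const t x)
  exact (hφ.hasFDerivAt.comp_hasDerivAt t h1).deriv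

theorem fderiv_space_eq {φ : ℝ × EuclideanSpace ℝ (Fin d) → ℝ} {t : ℝ}
    {x : EuclideanSpace ℝ (Fin d)} (hφ : DifferentiableAt ℝ φ (t, x))
    (w : EuclideanSpace ℝ (Fin d)) :
    fderiv ℝ (fun y => φ (t, y)) x w = fderiv ℝ φ (t, x) (0, w) := by
  have h1 : HasFDerivAt (fun y : EuclideanSpace ℝ (Fin d) => (t, y))
      (ContinuousLinearMap.inr ℝ ℝ (EuclideanSpace ℝ (Fin d))) x :=
    hasFDerivAt_prodMk_right t x
  have h2 := hφ.hasFDerivAt.comp x h1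
  have h3 : fderiv ℝ (fun y => φ (t, y)) x =
      (fderiv ℝ φ (t, x)).comp (ContinuousLinearMap.inr ℝ ℝ (EuclideanSpace ℝ (Fin d))) :=
    h2.fderiv
  rw [h3]
  simp

theorem inner_gradient_eq {φ : ℝ × EuclideanSpace ℝ (Fin d) → ℝ} {t : ℝ}
    {x : EuclideanSpace ℝ (Fin d)} (hφ : DifferentiableAt ℝ φ (t, x))
    (w : EuclideanSpace ℝ (Fin d)) :
    inner ℝ (gradient (fun y => φ (t, y)) x) w = fderiv ℝ φ (t, x) (0, w) := by
  rw [gradient, InnerProductSpace.toDual_symm_apply, fderiv_space_eq hφ]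

theorem continuous_gradient_space {φ : ℝ × EuclideanSpace ℝ (Fin d) → ℝ} (hφ : ContDiff ℝ 1 φ) :
    Continuous fun p : ℝ × EuclideanSpace ℝ (Fin d) => gradient (fun y => φ (p.1, y)) p.2 := by
  have hd : Differentiable ℝ φ := hφ.differentiable one_ne_zero
  have : (fun p : ℝ × EuclideanSpace ℝ (Fin d) => gradient (fun y => φ (p.1, y)) p.2) =
      fun p => (InnerProductSpace.toDual ℝ (EuclideanSpace ℝ (Fin d))).symm
        ((fderiv ℝ φ p).comp (ContinuousLinearMap.inr ℝ ℝ (EuclideanSpace ℝ (Fin d)))) := by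
    ext1 p
    rw [gradient]
    congr 1
    ext w
    rw [fderiv_space_eq (hd _)]
    simp
  rw [this]
  exact (LinearIsometryEquiv.continuous _).comp
    ((hφ.continuous_fderiv one_ne_zero).clm_comp continuous_const)

/-- The time derivative of a test function, restricted to `[0,1] × Ω`. -/
def timeDerivMap {φ : ℝ × EuclideanSpace ℝ (Fin d) → ℝ} (hφ : ContDiff ℝ 1 φ) : C(I × Ω, ℝ) where
  toFun p := fderiv ℝ φ ((p.1 : ℝ), (p.2 : EuclideanSpace ℝ (Fin d))) (1, 0)
  continuous_toFun := by
    have := hφ.continuous_fderiv one_ne_zero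
    fun_prop

/-- The space gradient of a test function, restricted to `[0,1] × Ω`. -/
def gradientMap {φ : ℝ × EuclideanSpace ℝ (Fin d) → ℝ} (hφ : ContDiff ℝ 1 φ) :
    C(I × Ω, EuclideanSpace ℝ (Fin d)) where
  toFun p := gradient (fun y => φ ((p.1 : ℝ), y)) (p.2 : EuclideanSpace ℝ (Fin d))
  continuous_toFun := by
    have := continuous_gradient_space hφ
    exact this.comp (by fun_prop :
      Continuous fun p : I × Ω => ((p.1 : ℝ), (p.2 : EuclideanSpace ℝ (Fin d))))

theorem integrable_continuousMap [CompactSpace Ω] (η : ProbabilityTheory.Kernel I Ω)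
    [ProbabilityTheory.IsMarkovKernel η] (g : C(I × Ω, ℝ)) :
    Integrable g (volume.compProd η) :=
  Integrable.of_bound g.continuous.measurable.aestronglyMeasurable ‖g‖
    (ae_of_all _ fun p => g.norm_coe_le_norm p)

/-- Each of the two terms is now a pairing with a continuous function on `[0,1] × Ω`, hence stable
under weak convergence. The kernel `η` is allowed to differ from the curve of `f`: the limit
momentum comes with a reference kernel of its own. -/
theorem continuityEquation_iff [CompactSpace Ω] {f : Flow Ω} (hρ : Continuous f.rho)
    {η : ProbabilityTheory.Kernel I Ω} [ProbabilityTheory.IsMarkovKernel η]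
    {v : I × Ω → EuclideanSpace ℝ (Fin d)} (h : HasDensity f η v) :
    ContinuityEquation f ↔ ∀ (φ : ℝ × EuclideanSpace ℝ (Fin d) → ℝ)
      (hφ : ContDiff ℝ ((⊤ : ℕ∞) : WithTop ℕ∞) φ),
      (∀ x ∈ Ω, φ (0, x) = 0 ∧ φ (1, x) = 0) →
      (∫ t : I, ∫ x : Ω, timeDerivMap (hφ.of_le (by simp)) (t, x) ∂(f.rho t : Measure Ω)) +
        ∫ t : I, pairing (f.mom t) (fun x => gradientMap (hφ.of_le (by simp)) (t, x)) = 0 := by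
  refine forall₂_congr fun φ hφ => forall_congr' fun _ => ?_
  have h1 : ContDiff ℝ 1 φ := hφ.of_le (by simp)
  have hd : Differentiable ℝ φ := h1.differentiable one_ne_zero
  rw [← integral_add]
  · refine Eq.congr_left (integral_congr_ae (ae_of_all _ fun t => ?_))
    dsimp only
    congr 1
    refine integral_congr_ae (ae_of_all _ fun x => ?_)
    exact deriv_time_eq (hd _)
  · exact integrable_integral_compProd (integrable_continuousMap (curveKernel hρ) _)
  · exact (h.integrable_pairing (ContinuousMap.continuous _).measurable
      (ContinuousMap.norm_coe_le_norm _)).1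

theorem continuityEquation_iff_compProd [CompactSpace Ω] {f : Flow Ω} (hρ : Continuous f.rho)
    {v : I × Ω → EuclideanSpace ℝ (Fin d)} (h : HasDensity f (curveKernel hρ) v) :
    ContinuityEquation f ↔ ∀ φ : ℝ × EuclideanSpace ℝ (Fin d) → ℝ,
      ContDiff ℝ ((⊤ : ℕ∞) : WithTop ℕ∞) φ → (∀ x ∈ Ω, φ (0, x) = 0 ∧ φ (1, x) = 0) →
      ∫ p : I × Ω, fderiv ℝ φ ((p.1 : ℝ), (p.2 : EuclideanSpace ℝ (Fin d))) (1, 0)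
          ∂(volume.compProd (curveKernel hρ)) +
        ∫ p : I × Ω, fderiv ℝ φ ((p.1 : ℝ), (p.2 : EuclideanSpace ℝ (Fin d))) (0, v p)
          ∂(volume.compProd (curveKernel hρ)) = 0 := by
  rw [continuityEquation_iff hρ h]
  refine forall₂_congr fun φ hφ => forall_congr' fun _ => ?_
  have h1 : ContDiff ℝ 1 φ := hφ.of_le (by simp)
  have hd : Differentiable ℝ φ := h1.differentiable one_ne_zero
  refine Eq.congr_left (congrArg₂ _ ?_ ?_)
  · exact (Measure.integral_compProd
      (integrable_continuousMap (curveKernel hρ) (timeDerivMap h1))).symm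
  · rw [(h.integrable_pairing (ContinuousMap.continuous _).measurable
      (ContinuousMap.norm_coe_le_norm _)).2]
    refine integral_congr_ae (ae_of_all _ fun p => ?_)
    exact inner_gradient_eq (hd _) _

/-! ### Equivalence of the continuity equation with the increment identity -/

/-- A weak form of the fundamental theorem of calculus. -/
theorem sub_eq_integral_of_weak_deriv {m g : ℝ → ℝ} (hm : ContinuousOn m (Set.Icc 0 1))
    (hg : IntervalIntegrable g volume 0 1)
    (h : ∀ η : ℝ → ℝ, ContDiff ℝ ((⊤ : ℕ∞) : WithTop ℕ∞) η → η 0 = 0 → η 1 = 0 →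
      (∫ t in (0 : ℝ)..1, deriv η t * m t) + ∫ t in (0 : ℝ)..1, η t * g t = 0) :
    ∀ r ∈ Set.Icc (0 : ℝ) 1, m r - m 0 = ∫ t in (0 : ℝ)..r, g t := by
  have h01 : Set.uIcc (0 : ℝ) 1 = Set.Icc 0 1 := Set.uIcc_of_le zero_le_one
  set G : ℝ → ℝ := fun r => ∫ t in (0 : ℝ)..r, g t with hG
  have hGac : AbsolutelyContinuousOnInterval G 0 1 :=
    hg.absolutelyContinuousOnInterval_intervalIntegral (by simp)
  have hG0 : G 0 = 0 := by simp [hG]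
  have hGd : ∀ᵐ t, t ∈ Set.uIcc (0 : ℝ) 1 → deriv G t = g t := by
    filter_upwards [hg.ae_hasDerivAt_integral] with t ht ht'
    exact (ht ht' 0 (by simp)).deriv
  -- The function `k` has zero weak derivative, so by the du Bois-Reymond argument it equals its
  -- mean `c`, first almost everywhere and then everywhere by continuity.
  set k : ℝ → ℝ := fun t => m t - G t with hk
  have hkc : ContinuousOn k (Set.Icc 0 1) := hm.sub (h01 ▸ hGac.continuousOn)
  set c : ℝ := ∫ t in (0 : ℝ)..1, k t with hc
  have hint : ∀ {u : ℝ → ℝ}, ContinuousOn u (Set.Icc 0 1) → IntervalIntegrable u volume 0 1 :=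
    fun hu => ContinuousOn.intervalIntegrable (h01.symm ▸ hu)
  have hmul : ∀ {u w : ℝ → ℝ}, ContinuousOn u (Set.Icc 0 1) → ContinuousOn w (Set.Icc 0 1) →
      IntervalIntegrable (fun t => u t * w t) volume 0 1 := fun hu hw => hint (hu.mul hw)
  have key : ∀ ψ : ℝ → ℝ, ContDiff ℝ ((⊤ : ℕ∞) : WithTop ℕ∞) ψ →
      ∫ t in (0 : ℝ)..1, ψ t * (k t - c) = 0 := by
    intro ψ hψ
    set a : ℝ := ∫ t in (0 : ℝ)..1, ψ t with ha
    -- Subtracting the mean `a` of `ψ` makes the primitive vanish at both endpoints, so it is an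
    -- allowed test function.
    set η : ℝ → ℝ := fun r => (∫ t in (0 : ℝ)..r, ψ t) - a * r with hη
    have hηd : ∀ r, HasDerivAt η (ψ r - a) r := fun r => by
      have h1 := intervalIntegral.integral_hasDerivAt_right
        (hψ.continuous.intervalIntegrable 0 r)
        hψ.continuous.stronglyMeasurable.stronglyMeasurableAtFilter hψ.continuous.continuousAt
      have h2 := h1.sub ((hasDerivAt_id r).const_mul a)
      rw [mul_one] at h2
      exact h2
    have hηd' : deriv η = fun r => ψ r - a := funext fun r => (hηd r).deriv
    have hηs : ContDiff ℝ ((⊤ : ℕ∞) : WithTop ℕ∞) η := by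
      rw [contDiff_infty_iff_deriv]
      refine ⟨fun r => (hηd r).differentiableAt, ?_⟩
      rw [hηd']
      exact hψ.sub contDiff_const
    have hη0 : η 0 = 0 := by simp [hη]
    have hη1 : η 1 = 0 := by simp [hη, ha]
    have h1 := h η hηs hη0 hη1
    have hηac : AbsolutelyContinuousOnInterval η 0 1 :=
      (hηs.contDiffOn.of_le (by simp)).absolutelyContinuousOnInterval
    have h2 := hηac.integral_mul_deriv_eq_deriv_mul hGac
    rw [hη0, hη1, hG0] at h2
    have h3 : ∫ t in (0 : ℝ)..1, η t * deriv G t = ∫ t in (0 : ℝ)..1, η t * g t := by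
      refine intervalIntegral.integral_congr_ae ?_
      filter_upwards [hGd] with t ht ht'
      rw [ht (Set.uIoc_subset_uIcc ht')]
    rw [← h3, h2, hηd'] at h1
    beta_reduce at h1
    have hψa : ContinuousOn (fun r => ψ r - a) (Set.Icc 0 1) :=
      (hψ.continuous.sub continuous_const).continuousOn
    have hGc : ContinuousOn G (Set.Icc 0 1) := h01 ▸ hGac.continuousOn
    have h4 : ∫ t in (0 : ℝ)..1, (ψ t - a) * k t = 0 := by
      have : ∀ t, (ψ t - a) * k t = (ψ t - a) * m t - (ψ t - a) * G t := fun t => by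
        rw [hk]; ring
      simp_rw [this]
      rw [intervalIntegral.integral_sub (hmul hψa hm) (hmul hψa hGc)]
      linarith
    have h5 : ∫ t in (0 : ℝ)..1, ψ t * k t = a * c := by
      have : ∀ t, (ψ t - a) * k t = ψ t * k t - a * k t := fun t => by ring
      simp_rw [this] at h4
      rw [intervalIntegral.integral_sub (hmul hψ.continuous.continuousOn hkc)
        ((hint hkc).const_mul a), intervalIntegral.integral_const_mul] at h4
      linarith
    simp_rw [mul_sub]
    rw [intervalIntegral.integral_sub (hmul hψ.continuous.continuousOn hkc)
      ((hint hψ.continuous.continuousOn).mul_const c), intervalIntegral.integral_mul_const, h5]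
    ring
  have hkcc : ContinuousOn (fun t => k t - c) (Set.Icc 0 1) := hkc.sub continuousOn_const
  have hae : ∀ᵐ t, t ∈ Set.Ioo (0 : ℝ) 1 → k t - c = 0 := by
    refine isOpen_Ioo.ae_eq_zero_of_integral_contDiff_smul_eq_zero
      ((hkcc.mono Set.Ioo_subset_Icc_self).locallyIntegrableOn measurableSet_Ioo) ?_
    intro ψ hψ _ hsupp
    rw [← key ψ hψ, intervalIntegral.integral_of_le zero_le_one]
    refine (setIntegral_eq_integral_of_forall_compl_eq_zero fun t ht => ?_).symm
    have : t ∉ tsupport ψ := fun h => ht (Set.Ioo_subset_Ioc_self (hsupp h))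
    rw [image_eq_zero_of_notMem_tsupport this, zero_smul]
  have heq : Set.EqOn (fun t => k t - c) (fun _ => 0) (Set.Icc 0 1) := by
    refine Measure.eqOn_Icc_of_ae_eq volume zero_ne_one ?_ hkcc continuousOn_const
    rw [Measure.restrict_congr_set Ioo_ae_eq_Icc.symm, EventuallyEq, ae_restrict_iff' measurableSet_Ioo]
    exact hae
  intro r hr
  have h1 := heq hr
  have h2 := heq (Set.left_mem_Icc.2 zero_le_one)
  simp only [hk, hG0] at h1 h2
  change m r - m 0 = G r
  linarith

theorem setIntegral_Ici_unitInterval {E : Type*} [NormedAddCommGroup E] [NormedSpace ℝ E]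
    (g : ℝ → E) (a : I) : ∫ t in Set.Ici a, g t = ∫ r in (a : ℝ)..1, g r := by
  rw [← integral_indicator measurableSet_Ici]
  have : (Set.Ici a).indicator (fun t : I => g t) =
      fun t : I => (Set.Ici (a : ℝ)).indicator g t := by
    ext1 t
    by_cases h : a ≤ t
    · rw [Set.indicator_of_mem (by exact h), Set.indicator_of_mem (by exact h)]
    · rw [Set.indicator_of_notMem (by exact h), Set.indicator_of_notMem (by exact h)]
  rw [this, unitInterval.measurePreserving_coe.integral_comp unitInterval.measurableEmbedding_coe,
    integral_indicator measurableSet_Ici, Measure.restrict_restrict measurableSet_Ici,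
    intervalIntegral.integral_of_le a.2.2, ← integral_Icc_eq_integral_Ioc]
  congr 2
  ext r
  exact ⟨fun h => ⟨h.1, h.2.2⟩, fun h => ⟨h.1, a.2.1.trans h.1, h.2⟩⟩

/-- The increments of `t ↦ ∫ χ dκ_t` are the integrals of `∫ ∇χ · v_t dκ_t`. -/
def HasIncrements (κ : ProbabilityTheory.Kernel I Ω) (v : I × Ω → EuclideanSpace ℝ (Fin d)) :
    Prop :=
  ∀ χ : EuclideanSpace ℝ (Fin d) → ℝ, ContDiff ℝ ((⊤ : ℕ∞) : WithTop ℕ∞) χ → ∀ r : I,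
    ∫ x, χ x ∂κ r - ∫ x, χ x ∂κ 0 =
      ∫ t in Set.Iic r, ∫ x : Ω, fderiv ℝ χ x (v (t, x)) ∂κ t

theorem exists_bound_of_continuous {K F : Type*} [TopologicalSpace K] [CompactSpace K]
    [SeminormedAddCommGroup F] {L : K → F} (hL : Continuous L) : ∃ C, ∀ p, ‖L p‖ ≤ C := by
  obtain ⟨C, hC⟩ := isCompact_univ.exists_bound_of_continuousOn hL.continuousOn
  exact ⟨C, fun p => hC p trivial⟩

theorem integrable_clm_apply {K E : Type*} [TopologicalSpace K] [CompactSpace K]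
    [MeasurableSpace K] [OpensMeasurableSpace K] [NormedAddCommGroup E] [NormedSpace ℝ E]
    [SecondCountableTopologyEither K (E →L[ℝ] ℝ)] {μ : Measure K}
    {L : K → E →L[ℝ] ℝ} (hL : Continuous L) {v : K → E} (hv : Integrable v μ) :
    Integrable (fun p => L p (v p)) μ := by
  obtain ⟨C, hC⟩ := exists_bound_of_continuous hL
  refine (hv.norm.const_mul C).mono' ?_ (ae_of_all _ fun p => ?_)
  · exact isBoundedBilinearMap_apply.continuous.comp_aestronglyMeasurable
      (hL.aestronglyMeasurable.prodMk hv.aestronglyMeasurable)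
  · exact (L p).le_of_opNorm_le (hC p) _

/-- Tensor products `η(t) χ(x)` turn the equation into a weak derivative in one variable, to which
the weak fundamental theorem of calculus applies. -/
theorem hasIncrements_of_continuityEquation [CompactSpace Ω] {f : Flow Ω}
    (hρ : Continuous f.rho) {v : I × Ω → EuclideanSpace ℝ (Fin d)}
    (h : HasDensity f (curveKernel hρ) v) (hf : ContinuityEquation f) :
    HasIncrements (curveKernel hρ) v := by
  rw [continuityEquation_iff_compProd hρ h] at hf
  intro χ hχ r
  have hχ1 : ContDiff ℝ 1 χ := hχ.of_le (by simp)
  have hχd : Differentiable ℝ χ := hχ1.differentiable one_ne_zero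
  set κ := curveKernel hρ with hκ
  have hmc : Continuous fun t : I => ∫ x : Ω, χ x ∂κ t := by
    have hc : Continuous fun x : Ω => χ x := hχ.continuous.comp continuous_subtype_val
    exact (ProbabilityMeasure.continuous_iff_forall_continuousMap_continuous_integral.1 hρ)
      (⟨fun x : Ω => χ x, hc⟩ : C(Ω, ℝ))
  have hL : Continuous fun p : I × Ω => fderiv ℝ χ p.2 :=
    (hχ1.continuous_fderiv one_ne_zero).comp (continuous_subtype_val.comp continuous_snd)
  have hgi : Integrable (fun p : I × Ω => fderiv ℝ χ p.2 (v p)) (volume.compProd κ) :=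
    integrable_clm_apply hL h.integrable
  have hgi' : Integrable fun t : I => ∫ x : Ω, fderiv ℝ χ x (v (t, x)) ∂κ t :=
    integrable_integral_compProd hgi
  have hext : ∀ (u : I → ℝ) (t : I), Set.IccExtend (zero_le_one : (0 : ℝ) ≤ 1) u t = u t :=
    fun u t => Set.IccExtend_val _ _ t
  set m : ℝ → ℝ := Set.IccExtend zero_le_one fun t : I => ∫ x : Ω, χ x ∂κ t with hm
  set g : ℝ → ℝ := Set.IccExtend zero_le_one
    fun t : I => ∫ x : Ω, fderiv ℝ χ x (v (t, x)) ∂κ t with hg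
  have hmI : ∀ t : I, m t = ∫ x : Ω, χ x ∂κ t := fun t => hext _ t
  have hgI : ∀ t : I, g t = ∫ x : Ω, fderiv ℝ χ x (v (t, x)) ∂κ t := fun t => hext _ t
  have key := sub_eq_integral_of_weak_deriv (m := m) (g := g) hmc.Icc_extend'.continuousOn
    (intervalIntegrable_iff_unitInterval.2 (by simpa only [hgI] using hgi')) ?_ r r.2
  · rw [← setIntegral_Iic_unitInterval, hmI r] at key
    simp only [hgI] at key
    rw [← key, ← hmI 0, Set.Icc.coe_zero]
  · intro η hη hη0 hη1
    have hφ : ContDiff ℝ ((⊤ : ℕ∞) : WithTop ℕ∞)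
        fun p : ℝ × EuclideanSpace ℝ (Fin d) => η p.1 * χ p.2 :=
      (hη.comp contDiff_fst).mul (hχ.comp contDiff_snd)
    have hηd : Differentiable ℝ η := hη.differentiable (by simp)
    have hderiv : ∀ (t : ℝ) (x : EuclideanSpace ℝ (Fin d)) (a : ℝ) (w),
        fderiv ℝ (fun p : ℝ × EuclideanSpace ℝ (Fin d) => η p.1 * χ p.2) (t, x) (a, w) =
          η t * fderiv ℝ χ x w + χ x * (a * deriv η t) := by
      intro t x a w
      have h1 : HasFDerivAt (fun p : ℝ × EuclideanSpace ℝ (Fin d) => η p.1)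
          ((fderiv ℝ η t).comp (ContinuousLinearMap.fst ℝ _ _)) (t, x) :=
        HasFDerivAt.comp (t, x) (hηd t).hasFDerivAt hasFDerivAt_fst
      have h2 : HasFDerivAt (fun p : ℝ × EuclideanSpace ℝ (Fin d) => χ p.2)
          ((fderiv ℝ χ x).comp (ContinuousLinearMap.snd ℝ _ _)) (t, x) :=
        HasFDerivAt.comp (t, x) (hχd x).hasFDerivAt hasFDerivAt_snd
      have h3 := (h1.mul h2).fderiv
      have h4 : fderiv ℝ (fun p : ℝ × EuclideanSpace ℝ (Fin d) => η p.1 * χ p.2) (t, x) = _ := h3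
      rw [h4]
      simp
    have := hf _ hφ fun x _ => by simp [hη0, hη1]
    simp only [hderiv] at this
    simp only [map_zero, mul_zero, zero_mul, one_mul, zero_add, add_zero] at this
    rw [Measure.integral_compProd, Measure.integral_compProd] at this
    · refine Eq.trans ?_ this
      rw [← integral_unitInterval fun t => deriv η t * m t,
        ← integral_unitInterval fun t => η t * g t]
      refine congrArg₂ _ (integral_congr_ae (ae_of_all _ fun t => ?_))
        (integral_congr_ae (ae_of_all _ fun t => ?_))
      · dsimp only
        rw [integral_mul_const, hmI, mul_comm]
      · dsimp only
        rw [integral_const_mul, hgI]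
    · have hc : Continuous fun p : I × Ω => η p.1 • fderiv ℝ χ p.2 :=
        (hη.continuous.comp (continuous_subtype_val.comp continuous_fst)).smul hL
      exact integrable_clm_apply hc h.integrable
    · have hc : Continuous fun p : I × Ω => χ p.2 * deriv η p.1 :=
        (hχ.continuous.comp (continuous_subtype_val.comp continuous_snd)).mul
          ((hη.continuous_deriv (by simp)).comp (continuous_subtype_val.comp continuous_fst))
      exact integrable_continuousMap κ ⟨_, hc⟩

/-- Symmetry of the second derivative exchanges the time and space differentiations. -/
theorem hasDerivAt_fderiv_space {φ : ℝ × EuclideanSpace ℝ (Fin d) → ℝ}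
    (hφ : ContDiff ℝ ((⊤ : ℕ∞) : WithTop ℕ∞) φ) (x w : EuclideanSpace ℝ (Fin d)) (r : ℝ) :
    HasDerivAt (fun s : ℝ => fderiv ℝ φ (s, x) (0, w))
      (fderiv ℝ (fun y => fderiv ℝ φ (r, y) (1, 0)) x w) r := by
  have hD : ContDiff ℝ ((⊤ : ℕ∞) : WithTop ℕ∞) (fderiv ℝ φ) :=
    hφ.fderiv_right (by simp)
  have hDd : Differentiable ℝ (fderiv ℝ φ) := hD.differentiable (by simp)
  have hsymm : IsSymmSndFDerivAt ℝ φ (r, x) :=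
    hφ.contDiffAt.isSymmSndFDerivAt (by
      rw [minSmoothness_of_isRCLikeNormedField]
      exact WithTop.coe_le_coe.2 (le_top : (2 : ℕ∞) ≤ ⊤))
  have h1 : HasDerivAt (fun s : ℝ => fderiv ℝ φ (s, x))
      (fderiv ℝ (fderiv ℝ φ) (r, x) (1, 0)) r :=
    (hDd (r, x)).hasFDerivAt.comp_hasDerivAt r
      ((hasDerivAt_id r).prodMk (hasDerivAt_const r x))
  have h2 : HasDerivAt (fun s : ℝ => fderiv ℝ φ (s, x) (0, w))
      (fderiv ℝ (fderiv ℝ φ) (r, x) (1, 0) (0, w)) r := by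
    simpa using h1.clm_apply (hasDerivAt_const r ((0 : ℝ), w))
  have h3 : HasFDerivAt (fun p => fderiv ℝ φ p ((1 : ℝ), (0 : EuclideanSpace ℝ (Fin d))))
      ((fderiv ℝ (fderiv ℝ φ) (r, x)).flip (1, 0)) (r, x) := by
    simpa using (hDd (r, x)).hasFDerivAt.clm_apply
      (hasFDerivAt_const ((1 : ℝ), (0 : EuclideanSpace ℝ (Fin d))) (r, x))
  have h4 := fderiv_space_eq h3.differentiableAt w
  rw [h3.fderiv] at h4
  rw [h4, ContinuousLinearMap.flip_apply, ← hsymm.eq]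
  exact h2

/-- For a general `φ`, the increment identity up to time `r` is applied to the frozen function `∂_t
φ(r, ·)` and integrated in `r`. Fubini on the triangle `t ≤ r` leaves an inner integral over `r ∈
[t,1]` of `D_x ∂_t φ · v`, which equals `D_x φ(1, ·) · v - D_x φ(t, ·) · v`. Both boundary
contributions, `hinit` and `hfinal`, vanish. -/
theorem continuityEquation_of_hasIncrements [CompactSpace Ω] {f : Flow Ω}
    (hρ : Continuous f.rho) {v : I × Ω → EuclideanSpace ℝ (Fin d)}
    (h : HasDensity f (curveKernel hρ) v) (hv : HasIncrements (curveKernel hρ) v) :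
    ContinuityEquation f := by
  rw [continuityEquation_iff_compProd hρ h]
  intro φ hφ hφ0
  set κ := curveKernel hρ with hκ
  have hφ1 : ContDiff ℝ 1 φ := hφ.of_le (by simp)
  have hφd : Differentiable ℝ φ := hφ1.differentiable one_ne_zero
  have hD : ContDiff ℝ ((⊤ : ℕ∞) : WithTop ℕ∞) (fderiv ℝ φ) := hφ.fderiv_right (by simp)
  set a : ℝ × EuclideanSpace ℝ (Fin d) → ℝ := fun p => fderiv ℝ φ p (1, 0) with ha
  have has : ContDiff ℝ ((⊤ : ℕ∞) : WithTop ℕ∞) a := hD.clm_apply contDiff_const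
  have had : Differentiable ℝ a := has.differentiable (by simp)
  have hax : ∀ r : ℝ, ContDiff ℝ ((⊤ : ℕ∞) : WithTop ℕ∞) fun y => a (r, y) := fun r =>
    has.comp (contDiff_prodMk_right r)
  have hac : Continuous fun p : I × Ω => a ((p.1 : ℝ), (p.2 : EuclideanSpace ℝ (Fin d))) :=
    has.continuous.comp (by fun_prop)
  have hLc : Continuous fun p : ℝ × EuclideanSpace ℝ (Fin d) =>
      fderiv ℝ (fun y => a (p.1, y)) p.2 := by
    have : (fun p : ℝ × EuclideanSpace ℝ (Fin d) => fderiv ℝ (fun y => a (p.1, y)) p.2) =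
        fun p => (fderiv ℝ a p).comp (ContinuousLinearMap.inr ℝ ℝ _) := by
      ext p w
      rw [fderiv_space_eq (had _)]
      simp
    rw [this]
    exact (has.continuous_fderiv (by simp)).clm_comp continuous_const
  set F : I → I × Ω → ℝ := fun r p => {r' : I | p.1 ≤ r'}.indicator
    (fun r' => fderiv ℝ (fun y => a (r', y)) p.2 (v p)) r with hF
  have hFi : Integrable (Function.uncurry F) ((volume : Measure I).prod (volume.compProd κ)) := by
    have h1 : Integrable (fun q : I × I × Ω =>
        fderiv ℝ (fun y => a (q.1, y)) q.2.2 (v q.2))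
        ((volume : Measure I).prod (volume.compProd κ)) := by
      have hc : Continuous fun q : I × I × Ω => fderiv ℝ (fun y => a ((q.1 : ℝ), y))
          (q.2.2 : EuclideanSpace ℝ (Fin d)) :=
        hLc.comp (by fun_prop : Continuous fun q : I × I × Ω =>
          ((q.1 : ℝ), (q.2.2 : EuclideanSpace ℝ (Fin d))))
      exact integrable_clm_apply hc (h.integrable.comp_snd volume)
    have hs : MeasurableSet {q : I × I × Ω | q.2.1 ≤ q.1} :=
      measurableSet_le (measurable_fst.comp measurable_snd) measurable_fst
    exact h1.indicator hs
  have hswap := integral_integral_swap hFi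
  have hleft : ∀ r : I, ∫ p, F r p ∂(volume.compProd κ) =
      ∫ x : Ω, a (r, x) ∂κ r - ∫ x : Ω, a (r, x) ∂κ 0 := by
    intro r
    rw [hv _ (hax r) r]
    have hc : Continuous fun p : I × Ω => fderiv ℝ (fun y => a (r, y)) p.2 :=
      hLc.comp (by fun_prop : Continuous fun p : I × Ω =>
        ((r : ℝ), (p.2 : EuclideanSpace ℝ (Fin d))))
    have hi := integrable_clm_apply hc h.integrable
    have : F r = (Set.Iic r ×ˢ Set.univ).indicator
        fun p : I × Ω => fderiv ℝ (fun y => a (r, y)) p.2 (v p) := by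
      ext1 p
      by_cases hp : p.1 ≤ r
      · rw [Set.indicator_of_mem (by exact ⟨hp, trivial⟩)]
        exact Set.indicator_of_mem (by exact hp) _
      · rw [Set.indicator_of_notMem (by exact fun h => hp h.1)]
        exact Set.indicator_of_notMem (by exact hp) _
    rw [this, integral_indicator (measurableSet_Iic.prod MeasurableSet.univ),
      Measure.setIntegral_compProd measurableSet_Iic MeasurableSet.univ hi.integrableOn]
    simp only [Measure.restrict_univ]
  have hright : ∀ p : I × Ω, ∫ r, F r p = fderiv ℝ φ (1, (p.2 : EuclideanSpace ℝ (Fin d))) (0, v p) -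
      fderiv ℝ φ ((p.1 : ℝ), (p.2 : EuclideanSpace ℝ (Fin d))) (0, v p) := by
    intro p
    have hset : {r' : I | p.1 ≤ r'} = Set.Ici p.1 := rfl
    simp only [hF, hset]
    rw [integral_indicator measurableSet_Ici, setIntegral_Ici_unitInterval
      (fun r => fderiv ℝ (fun y => a (r, y)) (p.2 : EuclideanSpace ℝ (Fin d)) (v p))]
    refine intervalIntegral.integral_eq_sub_of_hasDerivAt
      (fun r _ => hasDerivAt_fderiv_space hφ _ (v p) r) ?_
    refine Continuous.intervalIntegrable ?_ _ _
    have hc : Continuous fun r : ℝ =>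
        fderiv ℝ (fun y => a (r, y)) (p.2 : EuclideanSpace ℝ (Fin d)) :=
      hLc.comp (by fun_prop : Continuous fun r : ℝ =>
        (r, (p.2 : EuclideanSpace ℝ (Fin d))))
    exact hc.clm_apply continuous_const
  simp only [hleft, hright] at hswap
  have hgc : ∀ c : I → ℝ, Continuous c → Integrable (fun p : I × Ω =>
      fderiv ℝ φ (c p.1, (p.2 : EuclideanSpace ℝ (Fin d))) (0, v p)) (volume.compProd κ) := by
    intro c hc
    have h1 : Continuous fun p : I × Ω => (fderiv ℝ φ (c p.1, (p.2 : EuclideanSpace ℝ (Fin d)))).comp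
        (ContinuousLinearMap.inr ℝ ℝ (EuclideanSpace ℝ (Fin d))) :=
      ((hφ1.continuous_fderiv one_ne_zero).comp (by fun_prop)).clm_comp continuous_const
    simpa using integrable_clm_apply h1 h.integrable
  have hai : Integrable (fun p : I × Ω => a ((p.1 : ℝ), (p.2 : EuclideanSpace ℝ (Fin d))))
      (volume.compProd κ) := integrable_continuousMap κ ⟨_, hac⟩
  have hai1 : Integrable fun r : I => ∫ x : Ω, a (r, x) ∂κ r := integrable_integral_compProd hai
  have hai0 : Integrable (fun p : I × Ω => a ((p.1 : ℝ), (p.2 : EuclideanSpace ℝ (Fin d))))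
      ((volume : Measure I).prod (κ 0)) :=
    Integrable.of_bound hac.measurable.aestronglyMeasurable _
      (ae_of_all _ fun p => (⟨_, hac⟩ : C(I × Ω, ℝ)).norm_coe_le_norm p)
  have hai2 : Integrable fun r : I => ∫ x : Ω, a (r, x) ∂κ 0 := hai0.integral_prod_left
  -- For fixed `x` the time integral of `∂_t φ` is `φ(1,x) - φ(0,x) = 0`.
  have hinit : ∫ r : I, ∫ x : Ω, a (r, x) ∂κ 0 = 0 := by
    rw [integral_integral_swap hai0]
    refine integral_eq_zero_of_ae (ae_of_all _ fun x => ?_)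
    dsimp only [Pi.zero_apply]
    rw [integral_unitInterval fun r => a (r, (x : EuclideanSpace ℝ (Fin d))),
      intervalIntegral.integral_eq_sub_of_hasDerivAt (f := fun r => φ (r, (x : EuclideanSpace ℝ (Fin d))))]
    · rw [(hφ0 x x.2).1, (hφ0 x x.2).2, sub_zero]
    · intro r _
      exact (hφd _).hasFDerivAt.comp_hasDerivAt r
        ((hasDerivAt_id r).prodMk (hasDerivAt_const r (x : EuclideanSpace ℝ (Fin d))))
    · exact (has.continuous.comp (by fun_prop)).intervalIntegrable _ _
  -- Although `φ(1, ·)` vanishes on `Ω`, its gradient need not when `Ω` has empty interior. The term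
  -- vanishes only after integration, by the increment identity for `φ(1, ·)` over all of `[0,1]`.
  have hfinal : ∫ p : I × Ω, fderiv ℝ φ (1, (p.2 : EuclideanSpace ℝ (Fin d))) (0, v p)
      ∂(volume.compProd κ) = 0 := by
    have h1 := hv (fun y => φ (1, y)) (hφ.comp (contDiff_prodMk_right 1)) 1
    have h2 : ∀ t, ∫ x : Ω, φ (1, x) ∂κ t = 0 := fun t =>
      integral_eq_zero_of_ae (ae_of_all _ fun x => (hφ0 x x.2).2)
    have h3 : Set.Iic (1 : I) = Set.univ := Set.eq_univ_of_forall fun t => t.2.2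
    rw [h2, h2, sub_zero, h3, Measure.restrict_univ] at h1
    simp only [fderiv_space_eq (hφd _)] at h1
    rw [Measure.integral_compProd (hgc (fun _ => 1) continuous_const)]
    exact h1.symm
  rw [integral_sub hai1 hai2, hinit, sub_zero,
    integral_sub (hgc (fun _ => 1) continuous_const) (hgc _ continuous_subtype_val), hfinal,
    zero_sub] at hswap
  rw [Measure.integral_compProd hai]
  linarith

/-! ### Reparametrization to bounded cost -/

theorem ae_comp_timeChange {φ : I ≃o I} {k : I → ℝ}
    (hφ : Measure.map φ volume = volume.withDensity fun t => ENNReal.ofReal (k t))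
    {p : I → Prop} (hp : ∀ᵐ t, p t) : ∀ᵐ t, p (φ t) := by
  have hm : Measurable φ := φ.monotone.measurable
  refine ae_of_ae_map hm.aemeasurable ?_
  rw [hφ]
  exact (withDensity_absolutelyContinuous _ _).ae_le hp

theorem setIntegral_comp_timeChange {F : Type*} [NormedAddCommGroup F] [NormedSpace ℝ F]
    {φ : I ≃o I} {k : I → ℝ} (hk : Measurable k) (hk0 : ∀ t, 0 < k t)
    (hφ : Measure.map φ volume = volume.withDensity fun t => ENNReal.ofReal (k t))
    (g : I → F) (r : I) :
    ∫ t in Set.Iic r, (k (φ t))⁻¹ • g (φ t) = ∫ s in Set.Iic (φ r), g s := by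
  rw [← integral_indicator measurableSet_Iic, ← integral_indicator measurableSet_Iic]
  have h1 : (Set.Iic r).indicator (fun t => (k (φ t))⁻¹ • g (φ t)) =
      fun t => (Set.Iic (φ r)).indicator (fun s => (k s)⁻¹ • g s) (φ t) := by
    ext1 t
    by_cases h : t ≤ r
    · rw [Set.indicator_of_mem (by exact h), Set.indicator_of_mem (by exact φ.monotone h)]
    · rw [Set.indicator_of_notMem (by exact h),
        Set.indicator_of_notMem (by exact fun h' => h (φ.le_iff_le.1 h'))]
  have h2 := integral_map_equiv (μ := volume) φ.toHomeomorph.toMeasurableEquiv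
    ((Set.Iic (φ r)).indicator fun s => (k s)⁻¹ • g s)
  have h3 : (φ.toHomeomorph.toMeasurableEquiv : I → I) = φ := rfl
  rw [h3, hφ] at h2
  rw [h1, ← h2, integral_withDensity_eq_integral_toReal_smul hk.ennreal_ofReal
    (ae_of_all _ fun _ => ENNReal.ofReal_lt_top)]
  refine integral_congr_ae (ae_of_all _ fun s => ?_)
  dsimp only
  by_cases h : s ≤ φ r
  · rw [Set.indicator_of_mem (by exact h), Set.indicator_of_mem (by exact h),
      ENNReal.toReal_ofReal (hk0 s).le, smul_inv_smul₀ (hk0 s).ne']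
  · rw [Set.indicator_of_notMem (by exact h), Set.indicator_of_notMem (by exact h), smul_zero]

theorem integrable_compProd_of_lintegral_le {T X E : Type*} [MeasurableSpace T]
    [MeasurableSpace X] [NormedAddCommGroup E] [MeasurableSpace E] [BorelSpace E]
    [SecondCountableTopology E] {μ : Measure T} [SFinite μ] {η : ProbabilityTheory.Kernel T X}
    [ProbabilityTheory.IsSFiniteKernel η] {v : T × X → E} (hv : Measurable v) {h : T → ℝ≥0∞}
    (hle : ∀ᵐ t ∂μ, ∫⁻ x, ‖v (t, x)‖ₑ ∂η t ≤ h t) (hh : ∫⁻ t, h t ∂μ < ⊤) :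
    Integrable v (μ.compProd η) := by
  refine ⟨hv.aestronglyMeasurable, ?_⟩
  rw [HasFiniteIntegral, Measure.lintegral_compProd hv.enorm]
  exact (lintegral_mono_ae hle).trans_lt hh

/-- Only integrals over `Iic r` in time are involved, so the change of variables formula is enough
and no smoothness of `φ` is required. -/
theorem HasIncrements.timeChange {κ κ' : ProbabilityTheory.Kernel I Ω}
    {v v' : I × Ω → EuclideanSpace ℝ (Fin d)} (h : HasIncrements κ v) {φ : I ≃o I} {k : I → ℝ}
    (hk : Measurable k) (hk0 : ∀ t, 0 < k t)
    (hφ : Measure.map φ volume = volume.withDensity fun t => ENNReal.ofReal (k t))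
    (hκ : ∀ t, κ' t = κ (φ t)) (hv : ∀ t x, v' (t, x) = (k (φ t))⁻¹ • v (φ t, x)) :
    HasIncrements κ' v' := by
  intro χ hχ r
  have h0 : φ 0 = 0 := φ.map_bot
  rw [hκ, hκ, h0, h χ hχ, ← setIntegral_comp_timeChange hk hk0 hφ]
  refine integral_congr_ae (ae_of_all _ fun t => ?_)
  dsimp only
  rw [hκ, smul_eq_mul, ← integral_const_mul]
  simp only [hv, map_smul, smul_eq_mul]

/-- Every admissible pair of finite total cost has a reparametrization with bounded speed. -/
theorem exists_reparametrization [CompactSpace Ω] {α : ℝ} (hα : 0 < α) (hα' : α < 1) {f : Flow Ω}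
    (hf : IsAdmissible f) {C : ℝ≥0} (hC : totalCost α f ≤ C) :
    ∃ (g : Flow Ω) (hg : Continuous g.rho) (v : I × Ω → EuclideanSpace ℝ (Fin d)),
      IsTimeReparametrization f g ∧ IsAdmissible g ∧
      (∀ t, momentumCost α (g.rho t : Measure Ω) (g.mom t) ≤ (1 + C : ℝ≥0)) ∧
      HasDensity g (curveKernel hg) v ∧
      (∀ᵐ t, ∫⁻ x, ‖v (t, x)‖ₑ ∂(curveKernel hg t) ≤ (1 + C : ℝ≥0)) ∧
      HasIncrements (curveKernel hg) v := by
  classical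
  obtain ⟨v, h, hv, hh, hhC, hae⟩ := exists_velocity hα hα' hf hC
  obtain ⟨φ, k, hφ1, hφ2, hk, hk0, hkh, hφ, hderiv⟩ := exists_timeChange hh hhC
  have hφm : Measurable φ := φ.monotone.measurable
  have hbound : ∀ t, ‖(k t)⁻¹‖ₑ * h t ≤ (1 + C : ℝ≥0) := by
    intro t
    rw [Real.enorm_eq_ofReal (inv_pos.2 (hk0 t)).le, ← ENNReal.ofReal_coe_nnreal (p := h t),
      ← ENNReal.ofReal_mul (inv_pos.2 (hk0 t)).le, ← ENNReal.ofReal_coe_nnreal (p := 1 + C)]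
    exact ENNReal.ofReal_le_ofReal (by simpa using hkh t)
  have hfd : HasDensity f (curveKernel hf.continuous_rho) v := by
    refine ⟨hv, integrable_compProd_of_lintegral_le hv (h := fun t => h t) ?_
      (hhC.trans_lt ENNReal.coe_lt_top), ?_⟩
    · filter_upwards [hae] with t ht using ht.2.2.2
    · filter_upwards [hae] with t ht using ht.2.2.1
  have hinc := hasIncrements_of_continuityEquation hf.continuous_rho hfd hf.continuityEquation
  -- The bound on the cost is required at every time, whereas the momentum is prescribed only almost
  -- everywhere. It is set to `0` on the null set of times where the cost bound by `h` fails.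
  let g : Flow Ω :=
    { rho := fun t => f.rho (φ t)
      mom := fun t => if momentumCost α (f.rho (φ t) : Measure Ω) (f.mom (φ t)) ≤ h (φ t) then
        (k (φ t))⁻¹ • f.mom (φ t) else 0 }
  have hg : Continuous g.rho := hf.continuous_rho.comp φ.continuous
  have hae' := ae_comp_timeChange hφ hae
  have hgmom : ∀ᵐ t, g.mom t = (k (φ t))⁻¹ • f.mom (φ t) := by
    filter_upwards [hae'] with t ht
    exact if_pos ht.1
  let w : I × Ω → EuclideanSpace ℝ (Fin d) := fun p => (k (φ p.1))⁻¹ • v (φ p.1, p.2)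
  have hw : Measurable w :=
    ((hk.comp (hφm.comp measurable_fst)).inv).smul
      (hv.comp ((hφm.comp measurable_fst).prodMk measurable_snd))
  have hwle : ∀ᵐ t, ∫⁻ x, ‖w (t, x)‖ₑ ∂(curveKernel hg t) ≤ (1 + C : ℝ≥0) := by
    filter_upwards [hae'] with t ht
    have : ∀ x, ‖w (t, x)‖ₑ = ‖(k (φ t))⁻¹‖ₑ * ‖v (φ t, x)‖ₑ := fun x => enorm_smul _ _
    simp only [this]
    have hvm : Measurable fun x => ‖v (φ t, x)‖ₑ := (hv.comp measurable_prodMk_left).enorm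
    rw [lintegral_const_mul _ hvm]
    exact (mul_le_mul_right ht.2.2.2 _).trans (hbound _)
  have hgd : HasDensity g (curveKernel hg) w := by
    refine ⟨hw, integrable_compProd_of_lintegral_le hw hwle (by simp), ?_⟩
    filter_upwards [hae', hgmom] with t ht ht'
    rw [ht', ht.2.2.1, ← withDensityᵥ_smul]
    rfl
  have hginc : HasIncrements (curveKernel hg) w :=
    hinc.timeChange hk hk0 hφ (fun _ => rfl) fun _ _ => rfl
  refine ⟨g, hg, w, ⟨φ, hφ1, hφ2, fun _ => rfl, ?_⟩,
    ⟨hg, hgd.memL1, continuityEquation_of_hasIncrements hg hgd hginc⟩, ?_, hgd, hwle, hginc⟩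
  · filter_upwards [hgmom, hderiv] with t h1 h2
    rw [h1, h2]
  · intro t
    by_cases ht : momentumCost α (f.rho (φ t) : Measure Ω) (f.mom (φ t)) ≤ h (φ t)
    · have h1 : g.mom t = (k (φ t))⁻¹ • f.mom (φ t) := if_pos ht
      rw [h1]
      refine (momentumCost_smul_le hα (ht.trans_lt ENNReal.coe_lt_top).ne _).trans ?_
      exact (mul_le_mul_right ht _).trans (hbound _)
    · have h1 : g.mom t = 0 := if_neg ht
      rw [h1, momentumCost_zero hα]
      exact zero_le

/-! ### Compactness of the curves of measures -/

theorem probabilityMeasure_tendsto_iff {X ι : Type*} [TopologicalSpace X] [CompactSpace X]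
    [MeasurableSpace X] [OpensMeasurableSpace X] {l : Filter ι} {μ : ι → ProbabilityMeasure X}
    {ν : ProbabilityMeasure X} :
    Tendsto μ l (𝓝 ν) ↔ ∀ g : C(X, ℝ), Tendsto (fun i => ∫ x, g x ∂(μ i : Measure X)) l
      (𝓝 (∫ x, g x ∂(ν : Measure X))) :=
  ProbabilityMeasure.tendsto_iff_forall_integral_tendsto.trans
    (ContinuousMap.equivBoundedOfCompact ..).symm.forall_congr_left

/-- An equicontinuous sequence of curves of probability measures on a compact metrizable space has a
subsequence that converges at every time, to a continuous curve. -/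
theorem exists_subseq_tendsto_curve {X : Type*} [TopologicalSpace X] [CompactSpace X]
    [TopologicalSpace.MetrizableSpace X] [MeasurableSpace X] [BorelSpace X]
    (R : ℕ → I → ProbabilityMeasure X)
    (hR : ∀ (g : C(X, ℝ)) (ε : ℝ), 0 < ε → ∃ δ > 0, ∀ n (s t : I), dist s t < δ →
      |∫ x, g x ∂(R n t : Measure X) - ∫ x, g x ∂(R n s : Measure X)| ≤ ε) :
    ∃ b : ℕ → ℕ, StrictMono b ∧ ∃ ρ : I → ProbabilityMeasure X, Continuous ρ ∧
      ∀ t, Tendsto (fun n => R (b n) t) atTop (𝓝 (ρ t)) := by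
  -- Compactness of the countable product over a dense sequence of times replaces a diagonal
  -- extraction.
  obtain ⟨x, b, hb, hx⟩ :=
    CompactSpace.tendsto_subseq fun n (k : ℕ) => R n (TopologicalSpace.denseSeq I k)
  rw [tendsto_pi_nhds] at hx
  -- At each time a further subsequence, depending on `t`, supplies the candidate limit.
  -- Equicontinuity and convergence at a nearby dense time make the whole sequence of integrals
  -- Cauchy, so it has the same limit.
  have hsub : ∀ t, ∃ ρ, ∃ e : ℕ → ℕ, StrictMono e ∧
      Tendsto (fun n => R (b (e n)) t) atTop (𝓝 ρ) := fun t =>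
    CompactSpace.tendsto_subseq fun n => R (b n) t
  choose ρ e he hρ using hsub
  have hlim : ∀ t, Tendsto (fun n => R (b n) t) atTop (𝓝 (ρ t)) := by
    intro t
    rw [probabilityMeasure_tendsto_iff]
    intro g
    refine tendsto_nhds_of_cauchySeq_of_subseq ?_ (he t).tendsto_atTop
      (probabilityMeasure_tendsto_iff.1 (hρ t) g)
    rw [Metric.cauchySeq_iff]
    intro ε hε
    obtain ⟨δ, hδ, hδ'⟩ := hR g (ε / 4) (by positivity)
    obtain ⟨k, hk⟩ := (TopologicalSpace.denseRange_denseSeq I).exists_dist_lt t hδ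
    obtain ⟨N, hN⟩ := Metric.cauchySeq_iff.1
      (probabilityMeasure_tendsto_iff.1 (hx k) g).cauchySeq (ε / 4) (by positivity)
    refine ⟨N, fun m hm n hn => ?_⟩
    have h1 := hN m hm n hn
    have h2 := hδ' (b m) t _ hk
    have h3 := hδ' (b n) t _ hk
    simp only [Function.comp_apply] at h1
    rw [Real.dist_eq, abs_lt] at h1 ⊢
    rw [abs_le] at h2 h3
    constructor <;> linarith [h1.1, h1.2, h2.1, h2.2, h3.1, h3.2]
  refine ⟨b, hb, ρ, ?_, hlim⟩
  rw [ProbabilityMeasure.continuous_iff_forall_continuousMap_continuous_integral]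
  intro g
  rw [Metric.continuous_iff]
  intro s ε hε
  obtain ⟨δ, hδ, hδ'⟩ := hR g (ε / 2) (by positivity)
  refine ⟨δ, hδ, fun t ht => ?_⟩
  have h1 := ((probabilityMeasure_tendsto_iff.1 (hlim t) g).sub
    (probabilityMeasure_tendsto_iff.1 (hlim s) g)).abs
  have h2 := le_of_tendsto h1 (Eventually.of_forall fun n => hδ' (b n) s t (by rwa [dist_comm]))
  rw [Real.dist_eq]
  linarith

/-- The restrictions of smooth functions to `Ω`. -/
def smoothSubalgebra (Ω : Set (EuclideanSpace ℝ (Fin d))) : Subalgebra ℝ C(Ω, ℝ) where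
  carrier := {g | ∃ χ : EuclideanSpace ℝ (Fin d) → ℝ,
    ContDiff ℝ ((⊤ : ℕ∞) : WithTop ℕ∞) χ ∧ ∀ x : Ω, g x = χ x}
  mul_mem' := by
    rintro f g ⟨χ, hχ, h1⟩ ⟨η, hη, h2⟩
    exact ⟨_, hχ.mul hη, fun x => by rw [ContinuousMap.mul_apply, h1, h2]⟩
  add_mem' := by
    rintro f g ⟨χ, hχ, h1⟩ ⟨η, hη, h2⟩
    exact ⟨_, hχ.add hη, fun x => by rw [ContinuousMap.add_apply, h1, h2]⟩
  algebraMap_mem' r := ⟨fun _ => r, contDiff_const, fun x => rfl⟩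

/-- Stone–Weierstrass: distinct points `x`, `y` are separated by the linear form `z ↦ ⟪x - y, z⟫`.
-/
theorem exists_contDiff_near [CompactSpace Ω] (g : C(Ω, ℝ)) {ε : ℝ} (hε : 0 < ε) :
    ∃ χ : EuclideanSpace ℝ (Fin d) → ℝ, ContDiff ℝ ((⊤ : ℕ∞) : WithTop ℕ∞) χ ∧
      ∀ x : Ω, |χ x - g x| ≤ ε := by
  have hsep : (smoothSubalgebra Ω).SeparatesPoints := by
    intro x y hxy
    have hc : ContDiff ℝ ((⊤ : ℕ∞) : WithTop ℕ∞) fun z : EuclideanSpace ℝ (Fin d) =>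
        inner ℝ ((x : EuclideanSpace ℝ (Fin d)) - y) z := contDiff_const.inner ℝ contDiff_id
    refine ⟨_, ⟨⟨fun z : Ω => inner ℝ ((x : EuclideanSpace ℝ (Fin d)) - y) z,
      hc.continuous.comp continuous_subtype_val⟩, ⟨_, hc, fun _ => rfl⟩, rfl⟩, fun h => hxy ?_⟩
    have h' : inner ℝ ((x : EuclideanSpace ℝ (Fin d)) - y) (x : EuclideanSpace ℝ (Fin d)) =
      inner ℝ ((x : EuclideanSpace ℝ (Fin d)) - y) (y : EuclideanSpace ℝ (Fin d)) := h
    rw [← sub_eq_zero, ← inner_sub_right, inner_self_eq_zero, sub_eq_zero] at h'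
    exact Subtype.ext h'
  obtain ⟨⟨f, χ, hχ, hf⟩, hfg⟩ :=
    ContinuousMap.exists_mem_subalgebra_near_continuousMap_of_separatesPoints _ hsep g ε hε
  refine ⟨χ, hχ, fun x => ?_⟩
  rw [← hf x]
  exact ((f - g).norm_coe_le_norm x).trans hfg.le

/-- The rate of change `∫ ∇χ · v_t dκ_t` is bounded by `B * M` at almost every time. The Lipschitz
constant depends only on `χ` and `M`, hence is uniform along the sequence. -/
theorem HasIncrements.abs_sub_le {κ : ProbabilityTheory.Kernel I Ω}
    [ProbabilityTheory.IsMarkovKernel κ] {v : I × Ω → EuclideanSpace ℝ (Fin d)}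
    (h : HasIncrements κ v) (hv : Measurable v) {M : ℝ≥0}
    (hM : ∀ᵐ t, ∫⁻ x, ‖v (t, x)‖ₑ ∂κ t ≤ M) {χ : EuclideanSpace ℝ (Fin d) → ℝ}
    (hχ : ContDiff ℝ ((⊤ : ℕ∞) : WithTop ℕ∞) χ) {B : ℝ≥0} (hB : ∀ x : Ω, ‖fderiv ℝ χ x‖ₑ ≤ B)
    (s t : I) : |∫ x, χ x ∂κ t - ∫ x, χ x ∂κ s| ≤ B * M * dist s t := by
  wlog hst : s ≤ t generalizing s t
  · rw [abs_sub_comm, dist_comm]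
    exact this t s (le_of_not_ge hst)
  have hle : ∀ᵐ r, ∫⁻ x : Ω, ‖fderiv ℝ χ x (v (r, x))‖ₑ ∂κ r ≤ (B * M : ℝ≥0) := by
    filter_upwards [hM] with r hr
    have hvm : Measurable fun x => ‖v (r, x)‖ₑ := (hv.comp measurable_prodMk_left).enorm
    calc ∫⁻ x : Ω, ‖fderiv ℝ χ x (v (r, x))‖ₑ ∂κ r ≤ ∫⁻ x : Ω, B * ‖v (r, x)‖ₑ ∂κ r :=
          lintegral_mono fun x => ((fderiv ℝ χ x).le_opENorm _).trans (mul_le_mul_left (hB x) _)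
      _ = B * ∫⁻ x : Ω, ‖v (r, x)‖ₑ ∂κ r := lintegral_const_mul _ hvm
      _ ≤ B * M := mul_le_mul_right hr _
      _ = (B * M : ℝ≥0) := by push_cast; rfl
  have hcm : Measurable fun p : I × Ω => fderiv ℝ χ p.2 (v p) := by
    have h1 : Continuous fun p : I × Ω => fderiv ℝ χ p.2 :=
      (hχ.continuous_fderiv (by simp)).comp (continuous_subtype_val.comp continuous_snd)
    exact isBoundedBilinearMap_apply.continuous.measurable.comp (h1.measurable.prodMk hv)
  have hint : Integrable fun r => ∫ x : Ω, fderiv ℝ χ x (v (r, x)) ∂κ r :=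
    integrable_integral_compProd (integrable_compProd_of_lintegral_le hcm hle
      (by rw [lintegral_const, measure_univ, mul_one]; exact ENNReal.coe_lt_top))
  have hnorm : ∀ᵐ r, ‖∫ x : Ω, fderiv ℝ χ x (v (r, x)) ∂κ r‖ ≤ B * M := by
    filter_upwards [hle] with r hr
    have h1 := (enorm_integral_le_lintegral_enorm _).trans hr
    rw [← ofReal_norm, ENNReal.ofReal_le_coe] at h1
    exact_mod_cast h1
  have h1 := h χ hχ t
  have h2 := h χ hχ s
  have h3 := setIntegral_sdiff (μ := volume) (measurableSet_Iic (a := s)) hint.integrableOn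
    (Set.Iic_subset_Iic.2 hst)
  have h4 : Set.Iic t \ Set.Iic s = Set.Ioc s t := by
    ext r
    simp [and_comm]
  rw [← h1, ← h2, sub_sub_sub_cancel_right, h4] at h3
  rw [← h3, ← Real.norm_eq_abs]
  refine (norm_setIntegral_le_of_norm_le_const_ae' (by simp) (C := B * M)
    (hnorm.mono fun r hr _ => hr)).trans (le_of_eq ?_)
  rw [measureReal_def, unitInterval.volume_Ioc,
    ENNReal.toReal_ofReal (sub_nonneg.2 (Subtype.coe_le_coe.2 hst)), dist_comm,
    Subtype.dist_eq, Real.dist_eq, abs_of_nonneg (sub_nonneg.2 (Subtype.coe_le_coe.2 hst))]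

theorem equicontinuous_of_hasIncrements [CompactSpace Ω] {M : ℝ≥0}
    {κ : ℕ → ProbabilityTheory.Kernel I Ω} [∀ n, ProbabilityTheory.IsMarkovKernel (κ n)]
    {v : ℕ → I × Ω → EuclideanSpace ℝ (Fin d)} (h : ∀ n, HasIncrements (κ n) (v n))
    (hv : ∀ n, Measurable (v n)) (hM : ∀ n, ∀ᵐ t, ∫⁻ x, ‖v n (t, x)‖ₑ ∂κ n t ≤ M)
    (g : C(Ω, ℝ)) (ε : ℝ) (hε : 0 < ε) : ∃ δ > 0, ∀ n (s t : I), dist s t < δ →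
      |∫ x, g x ∂κ n t - ∫ x, g x ∂κ n s| ≤ ε := by
  obtain ⟨χ, hχ, hχg⟩ := exists_contDiff_near g (ε := ε / 3) (by positivity)
  have hc : Continuous fun x : Ω => χ x := hχ.continuous.comp continuous_subtype_val
  have hL : Continuous fun x : Ω => fderiv ℝ χ x :=
    (hχ.continuous_fderiv (by simp)).comp continuous_subtype_val
  obtain ⟨B, hB⟩ := exists_bound_of_continuous hL
  have hB' : ∀ x : Ω, ‖fderiv ℝ χ x‖ₑ ≤ B.toNNReal := fun x => by
    rw [← ofReal_norm, ← ENNReal.ofReal]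
    exact ENNReal.ofReal_le_ofReal (hB x)
  have hclose : ∀ n t, |∫ x : Ω, χ x ∂κ n t - ∫ x, g x ∂κ n t| ≤ ε / 3 := by
    intro n t
    have hi : ∀ f : C(Ω, ℝ), Integrable f (κ n t) := fun f =>
      Integrable.of_bound f.continuous.measurable.aestronglyMeasurable ‖f‖
        (ae_of_all _ f.norm_coe_le_norm)
    have hi' : Integrable (fun x : Ω => χ x) (κ n t) := hi ⟨_, hc⟩
    rw [← integral_sub hi' (hi g), ← Real.norm_eq_abs]
    refine (norm_integral_le_of_norm_le_const (ae_of_all _ hχg)).trans ?_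
    simp
  have hpos : 0 < (B.toNNReal : ℝ) * M + 1 := by positivity
  -- The summand `1` only prevents division by zero.
  refine ⟨ε / 3 / (B.toNNReal * M + 1), by positivity, fun n s t hst => ?_⟩
  have h1 := (h n).abs_sub_le (hv n) (hM n) hχ hB' s t
  have h2 : (B.toNNReal : ℝ) * M * dist s t ≤ ε / 3 := by
    rw [lt_div_iff₀ hpos] at hst
    nlinarith [dist_nonneg (x := s) (y := t)]
  have h3 := hclose n s
  have h4 := hclose n t
  rw [abs_le] at h1 h3 h4 ⊢
  constructor <;> linarith [h1.1, h1.2, h3.1, h3.2, h4.1, h4.2]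

theorem tendsto_integral_curve [CompactSpace Ω] {R : ℕ → I → ProbabilityMeasure Ω}
    (hR : ∀ n, Continuous (R n)) {ρ : I → ProbabilityMeasure Ω}
    (h : ∀ t, Tendsto (fun n => R n t) atTop (𝓝 (ρ t))) (g : C(I × Ω, ℝ)) :
    Tendsto (fun n => ∫ t : I, ∫ x : Ω, g (t, x) ∂(R n t : Measure Ω)) atTop
      (𝓝 (∫ t : I, ∫ x : Ω, g (t, x) ∂(ρ t : Measure Ω))) := by
  refine tendsto_integral_of_dominated_convergence (fun _ => ‖g‖) (fun n => ?_)
    (integrable_const _) (fun n => ae_of_all _ fun t => ?_) (ae_of_all _ fun t => ?_)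
  · exact (integrable_integral_compProd
      (integrable_continuousMap (curveKernel (hR n)) g)).aestronglyMeasurable
  · refine (norm_integral_le_of_norm_le_const
      (ae_of_all _ fun x => g.norm_coe_le_norm (t, x))).trans ?_
    simp
  · exact probabilityMeasure_tendsto_iff.1 (h t) (g.comp (ContinuousMap.prodMk
      (ContinuousMap.const _ t) (ContinuousMap.id _)))

/-! ### Compactness of the momenta -/

theorem map_fst_withDensity_compProd {T X : Type*} [MeasurableSpace T] [MeasurableSpace X]
    {μ : Measure T} [SFinite μ] {η : ProbabilityTheory.Kernel T X}
    [ProbabilityTheory.IsSFiniteKernel η] {f : T × X → ℝ≥0∞} (hf : Measurable f) :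
    Measure.map Prod.fst ((μ.compProd η).withDensity f) =
      μ.withDensity fun t => ∫⁻ x, f (t, x) ∂η t := by
  ext A hA
  have h1 : Prod.fst ⁻¹' A = A ×ˢ (Set.univ : Set X) := by ext; simp
  rw [Measure.map_apply measurable_fst hA, withDensity_apply _ (measurable_fst hA),
    withDensity_apply _ hA, h1, Measure.setLIntegral_compProd hf hA MeasurableSet.univ]
  simp only [Measure.restrict_univ]

/-- The closed unit ball of `ℝ^d`. -/
abbrev unitBall (d : ℕ) : Set (EuclideanSpace ℝ (Fin d)) := Metric.closedBall 0 1

/-- The direction of a vector, in the closed unit ball. -/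
def unitDirection (e : EuclideanSpace ℝ (Fin d)) :
    unitBall d :=
  ⟨‖e‖⁻¹ • e, inv_norm_smul_mem_unitClosedBall e⟩

theorem measurable_unitDirection : Measurable (unitDirection (d := d)) :=
  ((measurable_norm.inv).smul measurable_id).subtype_mk

/-- A momentum of speed at most `M` is represented by a probability measure on
`[0,1] × Ω × closedBall 0 1` whose time marginal is the Lebesgue measure. -/
theorem exists_lift [CompactSpace Ω] {M : ℝ≥0} (hM : M ≠ 0) (κ : ProbabilityTheory.Kernel I Ω)
    [ProbabilityTheory.IsMarkovKernel κ] {v : I × Ω → EuclideanSpace ℝ (Fin d)}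
    (hv : Measurable v) (hle : ∀ᵐ t, ∫⁻ x, ‖v (t, x)‖ₑ ∂κ t ≤ M) :
    ∃ P : ProbabilityMeasure ((I × Ω) × unitBall d),
      Measure.map (fun z => z.1.1) (P : Measure ((I × Ω) × unitBall d)) = volume ∧
      ∀ Ψ : C(I × Ω, EuclideanSpace ℝ (Fin d)),
        ∫ z, inner ℝ (Ψ z.1) (z.2 : EuclideanSpace ℝ (Fin d)) ∂(P : Measure ((I × Ω) × unitBall d)) =
          (M : ℝ)⁻¹ * ∫ p, inner ℝ (Ψ p) (v p) ∂(volume.compProd κ) := by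
  set μ : Measure (I × Ω) := volume.compProd κ with hμ
  -- The weight `|v| / M` is carried by the direction of `v`. The missing mass `1 - N(t) / M` at
  -- time `t` is carried by the zero vector: it completes the time marginal to Lebesgue measure and
  -- contributes nothing to the pairing with `Ψ`.
  set f₁ : I × Ω → ℝ≥0∞ := fun p => (M : ℝ≥0∞)⁻¹ * ‖v p‖ₑ with hf₁
  set N : I → ℝ≥0∞ := fun t => ∫⁻ x, ‖v (t, x)‖ₑ ∂κ t with hN
  set f₂ : I × Ω → ℝ≥0∞ := fun p => 1 - (M : ℝ≥0∞)⁻¹ * N p.1 with hf₂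
  have hNm : Measurable N := hv.enorm.lintegral_kernel_prod_right'
  have hm₁ : Measurable f₁ := hv.enorm.const_mul _
  have hm₂ : Measurable f₂ := measurable_const.sub ((hNm.comp measurable_fst).const_mul _)
  set j₁ : I × Ω → (I × Ω) × unitBall d :=
    fun p => (p, unitDirection (v p)) with hj₁
  set j₂ : I × Ω → (I × Ω) × unitBall d :=
    fun p => (p, ⟨0, by simp⟩) with hj₂
  have hjm₁ : Measurable j₁ := measurable_id.prodMk (measurable_unitDirection.comp hv)
  have hjm₂ : Measurable j₂ := measurable_id.prodMk measurable_const
  set Q := Measure.map j₁ (μ.withDensity f₁) + Measure.map j₂ (μ.withDensity f₂) with hQ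
  have hfst : Measurable fun z : (I × Ω) × unitBall d =>
    z.1.1 := measurable_fst.comp measurable_fst
  have hmarg : Measure.map (fun z => z.1.1) Q = volume := by
    rw [hQ, Measure.map_add _ _ hfst, Measure.map_map hfst hjm₁, Measure.map_map hfst hjm₂]
    change Measure.map Prod.fst _ + Measure.map Prod.fst _ = _
    rw [map_fst_withDensity_compProd hm₁, map_fst_withDensity_compProd hm₂,
      ← withDensity_add_left hm₁.lintegral_kernel_prod_right']
    refine (withDensity_congr_ae ?_).trans withDensity_one
    filter_upwards [hle] with t ht
    have hvm : Measurable fun x => ‖v (t, x)‖ₑ := (hv.comp measurable_prodMk_left).enorm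
    have h1 : (M : ℝ≥0∞)⁻¹ * N t ≤ 1 := by
      rw [← ENNReal.inv_mul_cancel (a := (M : ℝ≥0∞)) (by simpa using hM) ENNReal.coe_ne_top]
      exact mul_le_mul_right ht _
    simp only [Pi.add_apply, hf₁, hf₂, Pi.one_apply]
    rw [lintegral_const_mul _ hvm, lintegral_const, measure_univ, mul_one]
    exact add_tsub_cancel_of_le h1
  have hprob : IsProbabilityMeasure Q := by
    constructor
    have h1 : Q Set.univ = Measure.map (fun z => z.1.1) Q Set.univ := by
      rw [Measure.map_apply hfst MeasurableSet.univ, Set.preimage_univ]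
    rw [h1, hmarg, measure_univ]
  refine ⟨⟨Q, hprob⟩, hmarg, fun Ψ => ?_⟩
  have hcont : Continuous fun z : (I × Ω) × unitBall d =>
      inner ℝ (Ψ z.1) (z.2 : EuclideanSpace ℝ (Fin d)) := by fun_prop
  have hQi : Integrable (fun z : (I × Ω) × unitBall d =>
      inner ℝ (Ψ z.1) (z.2 : EuclideanSpace ℝ (Fin d))) Q := by
    obtain ⟨C, hC⟩ := exists_bound_of_continuous hcont
    exact Integrable.of_bound hcont.measurable.aestronglyMeasurable C (ae_of_all _ hC)
  have hi := integrable_add_measure.1 hQi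
  change ∫ z, inner ℝ (Ψ z.1) (z.2 : EuclideanSpace ℝ (Fin d)) ∂Q = _
  rw [hQ, integral_add_measure hi.1 hi.2,
    integral_map hjm₁.aemeasurable hcont.measurable.aestronglyMeasurable,
    integral_map hjm₂.aemeasurable hcont.measurable.aestronglyMeasurable,
    integral_withDensity_eq_integral_toReal_smul hm₁ (ae_of_all _ fun p =>
      ENNReal.mul_lt_top (by simpa [pos_iff_ne_zero] using hM) enorm_lt_top)]
  simp only [hj₁, hj₂, unitDirection, inner_zero_right, integral_zero, add_zero, hf₁]
  rw [← integral_const_mul]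
  refine integral_congr_ae (ae_of_all _ fun p => ?_)
  dsimp only
  rw [inner_smul_right, ENNReal.toReal_mul, toReal_enorm, smul_eq_mul, mul_assoc,
    ENNReal.toReal_inv, ENNReal.coe_toReal]
  by_cases h0 : v p = 0
  · simp [h0]
  · rw [mul_inv_cancel_left₀ (norm_ne_zero_iff.2 h0)]

/-- Two conditionings: `ν` is the conditional law of the position given the time, and `w(t,x)` is
the barycentre of the conditional law of the vector in the ball given `(t,x)`. The barycentre stays
in the unit ball and suffices because the integrand is linear in that vector. -/
theorem exists_disintegration [CompactSpace Ω] [Nonempty Ω]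
    (P : ProbabilityMeasure ((I × Ω) × unitBall d))
    (hP : Measure.map (fun z => z.1.1) (P : Measure ((I × Ω) × unitBall d)) = volume) :
    ∃ (ν : ProbabilityTheory.Kernel I Ω) (_ : ProbabilityTheory.IsMarkovKernel ν)
      (w : I × Ω → EuclideanSpace ℝ (Fin d)), Measurable w ∧ (∀ p, ‖w p‖ ≤ 1) ∧
      ∀ Ψ : C(I × Ω, EuclideanSpace ℝ (Fin d)),
        ∫ z, inner ℝ (Ψ z.1) (z.2 : EuclideanSpace ℝ (Fin d)) ∂(P : Measure ((I × Ω) × unitBall d)) =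
          ∫ p, inner ℝ (Ψ p) (w p) ∂(volume.compProd ν) := by
  have hΩ : IsCompact Ω := isCompact_iff_compactSpace.2 inferInstance
  have : StandardBorelSpace Ω := hΩ.measurableSet.standardBorel
  have : StandardBorelSpace (unitBall d) :=
    Metric.isClosed_closedBall.measurableSet.standardBorel
  have : Nonempty (unitBall d) := ⟨⟨0, by simp⟩⟩
  have : CompactSpace (unitBall d) :=
    isCompact_iff_compactSpace.1 (isCompact_closedBall _ _)
  set m : Measure (I × Ω) := (P : Measure ((I × Ω) × unitBall d)).fst with hm
  set ν := m.condKernel with hν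
  set θ := (P : Measure ((I × Ω) × unitBall d)).condKernel with hθ
  have h1 : m.fst = volume := by
    rw [← hP, hm, Measure.fst, Measure.fst, Measure.map_map measurable_fst measurable_fst]
    rfl
  have h2 : (volume : Measure I).compProd ν = m := by
    rw [← h1]
    exact m.disintegrate ν
  refine ⟨ν, inferInstance, fun p => ∫ y, (y : EuclideanSpace ℝ (Fin d)) ∂θ p, ?_, fun p => ?_,
    fun Ψ => ?_⟩
  · refine StronglyMeasurable.measurable ?_
    exact StronglyMeasurable.integral_kernel_prod_right' (κ := θ)
      (f := fun z => (z.2 : EuclideanSpace ℝ (Fin d)))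
      (measurable_subtype_coe.comp measurable_snd).stronglyMeasurable
  · refine (norm_integral_le_of_norm_le_const (C := 1) (ae_of_all _ fun y => ?_)).trans ?_
    · exact mem_closedBall_zero_iff.1 y.2
    · simp
  · have hcont : Continuous fun z : (I × Ω) × unitBall d =>
        inner ℝ (Ψ z.1) (z.2 : EuclideanSpace ℝ (Fin d)) := by fun_prop
    obtain ⟨C, hC⟩ := exists_bound_of_continuous hcont
    have hi : Integrable (fun z : (I × Ω) × unitBall d =>
        inner ℝ (Ψ z.1) (z.2 : EuclideanSpace ℝ (Fin d))) (P : Measure ((I × Ω) × unitBall d)) :=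
      Integrable.of_bound hcont.measurable.aestronglyMeasurable C (ae_of_all _ hC)
    rw [h2, ← Measure.integral_condKernel hi]
    refine integral_congr_ae (ae_of_all _ fun p => ?_)
    dsimp only
    refine integral_inner ?_ _
    refine Integrable.of_bound measurable_subtype_coe.aestronglyMeasurable 1
      (ae_of_all _ fun y => ?_)
    exact mem_closedBall_zero_iff.1 y.2

/-- Weak sequential compactness of the momenta with bounded speed. -/
theorem exists_subseq_tendsto_momentum [CompactSpace Ω] [Nonempty Ω] {M : ℝ≥0} (hM : M ≠ 0)
    (κ : ℕ → ProbabilityTheory.Kernel I Ω) [∀ n, ProbabilityTheory.IsMarkovKernel (κ n)]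
    {v : ℕ → I × Ω → EuclideanSpace ℝ (Fin d)} (hv : ∀ n, Measurable (v n))
    (hle : ∀ n, ∀ᵐ t, ∫⁻ x, ‖v n (t, x)‖ₑ ∂κ n t ≤ M) :
    ∃ b : ℕ → ℕ, StrictMono b ∧ ∃ (ν : ProbabilityTheory.Kernel I Ω)
      (_ : ProbabilityTheory.IsMarkovKernel ν) (w : I × Ω → EuclideanSpace ℝ (Fin d)),
      Measurable w ∧ (∀ p, ‖w p‖ ≤ M) ∧ ∀ Ψ : C(I × Ω, EuclideanSpace ℝ (Fin d)),
        Tendsto (fun n => ∫ p, inner ℝ (Ψ p) (v (b n) p) ∂(volume.compProd (κ (b n)))) atTop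
          (𝓝 (∫ p, inner ℝ (Ψ p) (w p) ∂(volume.compProd ν))) := by
  have : CompactSpace (unitBall d) :=
    isCompact_iff_compactSpace.1 (isCompact_closedBall _ _)
  choose P hP hPΨ using fun n => exists_lift hM (κ n) (hv n) (hle n)
  obtain ⟨p, b, hb, hp⟩ := CompactSpace.tendsto_subseq P
  have hfst : Continuous fun z : (I × Ω) × unitBall d =>
    z.1.1 := continuous_fst.comp continuous_fst
  -- Marginals are weakly continuous, so the limit keeps Lebesgue measure as time marginal. This
  -- excludes concentration of the limit momentum in time.
  have hmarg : Measure.map (fun z => z.1.1) (p : Measure ((I × Ω) × unitBall d)) = volume := by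
    have h1 := ((ProbabilityMeasure.continuous_map hfst).tendsto p).comp hp
    let V : ProbabilityMeasure I := ⟨volume, inferInstance⟩
    have h2 : (fun q : ProbabilityMeasure ((I × Ω) × unitBall d) => q.map hfst.measurable.aemeasurable) ∘ P ∘ b =
        fun _ => V := funext fun n => Subtype.ext (hP (b n))
    rw [h2] at h1
    have h3 := tendsto_nhds_unique h1 tendsto_const_nhds
    exact congrArg (fun q : ProbabilityMeasure I => (q : Measure I)) h3
  obtain ⟨ν, hν, w, hw, hw1, hwΨ⟩ := exists_disintegration p hmarg
  have hM0 : (M : ℝ) ≠ 0 := by exact_mod_cast hM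
  refine ⟨b, hb, ν, hν, fun p => (M : ℝ) • w p, hw.const_smul (M : ℝ), fun p => ?_, fun Ψ => ?_⟩
  · rw [norm_smul, Real.norm_eq_abs, NNReal.abs_eq]
    exact mul_le_of_le_one_right M.2 (hw1 p)
  · have hcont : Continuous fun z : (I × Ω) × unitBall d =>
        inner ℝ (Ψ z.1) (z.2 : EuclideanSpace ℝ (Fin d)) := by fun_prop
    have h1 := ((ProbabilityMeasure.continuous_integral_continuousMap
      (⟨_, hcont⟩ : C(_, ℝ))).tendsto p).comp hp
    have h2 := h1.const_mul (M : ℝ)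
    simp only [inner_smul_right, integral_const_mul, ← hwΨ]
    refine h2.congr fun n => ?_
    simp only [Function.comp_apply, ContinuousMap.coe_mk, hPΨ]
    rw [mul_inv_cancel_left₀ hM0]

/-! ### Passage to the limit and conclusion -/

/-- Sequential compactness of the admissible pairs with bounded speed. -/
theorem exists_subseq_weakTendsto [CompactSpace Ω] [Nonempty Ω] {M : ℝ≥0} (hM : M ≠ 0)
    {u : ℕ → Flow Ω} (hu : ∀ n, IsAdmissible (u n))
    {v : ℕ → I × Ω → EuclideanSpace ℝ (Fin d)}
    (hd : ∀ n, HasDensity (u n) (curveKernel (hu n).continuous_rho) (v n))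
    (hle : ∀ n, ∀ᵐ t, ∫⁻ x, ‖v n (t, x)‖ₑ ∂(curveKernel (hu n).continuous_rho t) ≤ M) :
    ∃ b : ℕ → ℕ, StrictMono b ∧ ∃ f : Flow Ω, IsAdmissible f ∧
      WeakTendsto (fun n => u (b n)) f := by
  have hinc := fun n => hasIncrements_of_continuityEquation (hu n).continuous_rho (hd n)
    (hu n).continuityEquation
  obtain ⟨a, ha, ρ, hρ, hlim⟩ := exists_subseq_tendsto_curve (fun n => (u n).rho)
    (equicontinuous_of_hasIncrements hinc (fun n => (hd n).measurable) hle)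
  obtain ⟨b, hb, ν, hν, w, hw, hwM, hwlim⟩ := exists_subseq_tendsto_momentum hM
    (fun n => curveKernel (hu (a n)).continuous_rho) (fun n => (hd (a n)).measurable)
    (fun n => hle (a n))
  -- The kernel `ν` comes from the limit of the lifted momenta and is not identified with `ρ`.
  -- Admissibility asks only for a momentum integrable in time, not for one with a density with
  -- respect to `ρ_t`.
  let f : Flow Ω := ⟨ρ, fun t => (ν t).withDensityᵥ fun x => w (t, x)⟩
  have hf : HasDensity f ν w :=
    ⟨hw, Integrable.of_bound hw.aestronglyMeasurable M (ae_of_all _ hwM), ae_of_all _ fun _ => rfl⟩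
  have hweak : WeakTendsto (fun n => u (a (b n))) f := by
    refine ⟨tendsto_integral_curve (fun n => (hu (a (b n))).continuous_rho)
      fun t => (hlim t).comp hb.tendsto_atTop, fun Ψ => ?_⟩
    simp only [(hf.integrable_pairing Ψ.continuous.measurable Ψ.norm_coe_le_norm).2,
      ((hd _).integrable_pairing Ψ.continuous.measurable Ψ.norm_coe_le_norm).2]
    exact hwlim Ψ
  refine ⟨a ∘ b, ha.comp hb, f, ⟨hρ, hf.memL1, ?_⟩, hweak⟩
  rw [continuityEquation_iff (f := f) hρ hf]
  intro φ hφ hφ0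
  -- The left side of the equation converges by weak convergence and is zero for every `n`.
  refine tendsto_nhds_unique ((hweak.1 (timeDerivMap (hφ.of_le (by simp)))).add
    (hweak.2 (gradientMap (hφ.of_le (by simp))))) ?_
  refine tendsto_const_nhds.congr fun n => ?_
  exact ((continuityEquation_iff (hu _).continuous_rho (hd _)).1
    (hu (a (b n))).continuityEquation φ hφ hφ0).symm

end BranchedTransport

end

theorem mainTheorem3 {d : ℕ} {Ω : Set (EuclideanSpace ℝ (Fin d))}
    (hΩ_convex : Convex ℝ Ω) (hΩ_compact : IsCompact Ω)
    {α : ℝ} (hα_pos : 0 < α) (hα_lt : α < 1)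
    (u : ℕ → BranchedTransport.Flow Ω)
    (hu : ∀ n, BranchedTransport.IsAdmissible (u n))
    {C : ℝ≥0} (hC : ∀ n, BranchedTransport.totalCost α (u n) ≤ (C : ℝ≥0∞)) :
    ∃ w : ℕ → BranchedTransport.Flow Ω,
      (∀ n, BranchedTransport.IsTimeReparametrization (u n) (w n)) ∧
      (∀ n, BranchedTransport.IsAdmissible (w n)) ∧
      BranchedTransport.TauCompact α w := by
  have : CompactSpace Ω := isCompact_iff_compactSpace.1 hΩ_compact
  have : Nonempty Ω := ((u 0).rho 0).nonempty
  choose w hw v hrep hadm hcost hd hle _ using fun n =>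
    BranchedTransport.exists_reparametrization hα_pos hα_lt (hu n) (hC n)
  refine ⟨w, hrep, hadm, fun a _ => ?_⟩
  obtain ⟨b, hb, f, hf, hlim⟩ := BranchedTransport.exists_subseq_weakTendsto (M := 1 + C)
    (by positivity) (fun n => hadm (a n)) (fun n => hd (a n)) (fun n => hle (a n))
  exact ⟨b, hb, f, hf, hlim, (iSup₂_le fun n t => hcost _ t).trans_lt ENNReal.coe_lt_top⟩
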